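/- Let $H=L^2(\mathbb R^n)$ be the Hilbert space of $n$ bosonic modes, with displacement operators $D(\alpha)=\exp\big(\sum_k(\alpha_k a_k^\dagger-\alpha_k^* a_k)\big)$, $\alpha\in\mathbb C^n$. For a state (density operator) $\rho$ on $H$ let $\chi_\rho(\alpha)=\operatorname{Tr}[\rho D(\alpha)]$. For a symmetric unitary matrix $U\in\mathbb C^{n\times n}$ the reflected state $\rho^{(U)}$ of $\rho$ is the state with $\chi_{\rho^{(U)}}(\alpha)=\chi_\rho(U\alpha^*)$ for all $\alpha\in\mathbb C^n$. The linear-optical circuit of $U$ is a unitary operator $\mathcal U$ on $H$ with $\mathcal U^\dagger D(\alpha)\,\mathcal U=D(U^{\mathsf T}\alpha)$ for all $\alpha$. The Bell measurement on $H\otimes H$ is the POVM on $\mathbb C^n$ with the density $$\Pi(\zeta)=\pi^{-n}\,(I\otimes D(\zeta))\,|\Psi\rangle\langle\Psi|\,(I\otimes D(\zeta)^\dagger)$$ with respect to $d^{2n}\zeta$, where $|\Psi\rangle=\sum_k|k\rangle|k\rangle$ is the unnormalised maximally entangled vector over the number basis (the density is understood as a form on product vectors). There is a universal constant $C>0$ such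 that the following holds for every $n$ and every symmetric unitary $U\in\mathbb C^{n\times n}$. The circuit $\mathcal U$ and the Bell measurement exist, every $n$-mode state $\rho$ has a reflected state, and for every $n$-mode state $\rho$ with reflected state $\rho^{(U)}$, all $\epsilon,\delta>0$, and all integers $M,N$ with $M/\delta\ge 2$ and $$N\ \ge\ C\,\epsilon^{-4}\log(M/\delta),$$ the following scheme on $N$ copies of $\rho\otimes\rho^{(U)}$ succeeds. In each copy apply $\mathcal U$ to $\rho^{(U)}$ and perform the Bell measurement on $\rho\otimes\mathcal U\rho^{(U)}\mathcal U^\dagger$. This gives classical data $\zeta_1,\dots,\zeta_N\in\mathbb C^n$, which are independent and distributed by Born's rule; the measurement depends only on $n$ and $U$. For points $\alpha_1,\dots,\alpha_M\in\mathbb C^n$, arbitrary and chosen after the measurement, put $$\hat v_i=\frac1N\sum_{j=1}^N e^{-(\zeta_j\cdot\alpha_i-\zeta_j^*\cdot\alpha_i^*)},\qquad \hat u_i=\begin{cases}0,&|\hat v_i|\le\tfrac23\epsilon^2,\\ \sqrt{\hat v_i}\ \text{(principal square root)},&\text{otherwise.}\end{cases}$$ Then, with probability at least $1-\delta$, $$\min_{\tau\in\{\pm1\}}|\tau\hat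 u_i-\chi_\rho(\alpha_i)|\le\epsilon\qquad\text{for all } i=1,\dots,M .$$ In particular $N=O(\epsilon^{-4}\log(M/\delta))$ copies suffice, independently of $n$. -/

import Mathlib

open MeasureTheory UniformSpace
open scoped TensorProduct InnerProductSpace

noncomputable section

namespace CVLearning

/-! ### Trace, density operators, POVMs -/

section Hilbert

variable {H : Type*} [NormedAddCommGroup H] [InnerProductSpace ℂ H] [CompleteSpace H]

/-- The index set of some orthonormal (Hilbert) basis of `H`. -/
def basisIndex (H : Type*) [NormedAddCommGroup H] [InnerProductSpace ℂ H] [CompleteSpace H] :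
    Set H :=
  (exists_hilbertBasis ℂ H).choose

/-- Some orthonormal (Hilbert) basis of `H`. -/
def refBasis (H : Type*) [NormedAddCommGroup H] [InnerProductSpace ℂ H] [CompleteSpace H] :
    HilbertBasis (basisIndex H) ℂ H :=
  (exists_hilbertBasis ℂ H).choose_spec.choose

/-- The trace `∑ᵢ ⟨eᵢ, T eᵢ⟩`. It is only used for products of a density operator with a bounded
operator; these are trace class, so that the sum converges absolutely and does not depend on the
orthonormal basis. -/
def trace (T : H →L[ℂ] H) : ℂ :=
  ∑' i, ⟪refBasis H i, T (refBasis H i)⟫_ℂ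

/-- Quantum states: positive operators of trace one. (For a positive operator whose diagonal sum
diverges, `trace` is zero, so that `trace ρ = 1` does include that `ρ` is trace class.) -/
def IsDensityOperator (ρ : H →L[ℂ] H) : Prop :=
  ρ.IsPositive ∧ trace ρ = 1

/-- A positive operator-valued measure on `Ω`, acting on `H`; its values on non-measurable sets
are irrelevant. -/
structure POVM (Ω : Type*) [MeasurableSpace Ω] (H : Type*) [NormedAddCommGroup H]
    [InnerProductSpace ℂ H] [CompleteSpace H] where
  /-- The effect of the event `B`. -/
  effect : Set Ω → H →L[ℂ] H
  effect_isPositive : ∀ B, MeasurableSet B → (effect B).IsPositive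
  effect_univ : effect Set.univ = 1
  effect_iUnion : ∀ B : ℕ → Set Ω, (∀ k, MeasurableSet (B k)) →
    Pairwise (fun j k => Disjoint (B j) (B k)) →
      ∀ ψ : H, HasSum (fun k => effect (B k) ψ) (effect (⋃ k, B k) ψ)

/-- Born's rule: `μ` is the law of the outcome when `E` is measured in the state `ω`. -/
def IsOutcomeLaw {Ω : Type*} [MeasurableSpace Ω] (E : POVM Ω H) (ω : H →L[ℂ] H)
    (μ : Measure Ω) : Prop :=
  IsProbabilityMeasure μ ∧
    ∀ B, MeasurableSet B → ((μ.real B : ℝ) : ℂ) = trace (ω ∘L E.effect B)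

end Hilbert

/-! ### Hilbert space tensor products -/

section Tensor

variable {H K : Type*} [NormedAddCommGroup H] [InnerProductSpace ℂ H]
  [NormedAddCommGroup K] [InnerProductSpace ℂ K]

lemma exists_orthonormal_sum (t : H ⊗[ℂ] K) :
    ∃ (m : ℕ) (x : Fin m → H) (e : Fin m → K), Orthonormal ℂ e ∧ t = ∑ i, x i ⊗ₜ[ℂ] e i := by
  classical
  obtain ⟨S, rfl⟩ := TensorProduct.exists_finset t
  let F : Submodule ℂ K := Submodule.span ℂ ((S.image Prod.snd : Finset K) : Set K)
  have : FiniteDimensional ℂ F := FiniteDimensional.span_finset ℂ _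
  let b := stdOrthonormalBasis ℂ F
  refine ⟨_, fun i => ∑ s ∈ S, ⟪(b i : K), s.2⟫_ℂ • s.1, fun i => (b i : K),
    b.orthonormal.comp_linearIsometry F.subtypeₗᵢ, ?_⟩
  have key : ∀ s ∈ S, s.1 ⊗ₜ[ℂ] s.2 = ∑ i, (⟪(b i : K), s.2⟫_ℂ • s.1) ⊗ₜ[ℂ] (b i : K) := by
    intro s hs
    have hmem : s.2 ∈ F := Submodule.subset_span (by
      simpa using ⟨s.1, hs⟩)
    have h := congrArg (fun z : F => (z : K)) (b.sum_repr' ⟨s.2, hmem⟩)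
    simp only [Submodule.coe_sum, Submodule.coe_smul, Submodule.coe_inner] at h
    conv_lhs => rw [← h]
    rw [TensorProduct.tmul_sum]
    exact Finset.sum_congr rfl fun i _ => by
      rw [TensorProduct.tmul_smul, TensorProduct.smul_tmul']
  rw [Finset.sum_congr rfl key, Finset.sum_comm]
  exact Finset.sum_congr rfl fun i _ => by rw [TensorProduct.sum_tmul]

lemma norm_sq_orthonormal_sum {m : ℕ} (x : Fin m → H) {e : Fin m → K} (he : Orthonormal ℂ e) :
    ‖∑ i, x i ⊗ₜ[ℂ] e i‖ ^ 2 = ∑ i, ‖x i‖ ^ 2 := by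
  have h : ⟪∑ i, x i ⊗ₜ[ℂ] e i, ∑ i, x i ⊗ₜ[ℂ] e i⟫_ℂ = ∑ i, ((‖x i‖ ^ 2 : ℝ) : ℂ) := by
    rw [sum_inner]
    refine Finset.sum_congr rfl fun i _ => ?_
    rw [inner_sum, Finset.sum_eq_single i]
    · rw [TensorProduct.inner_tmul, inner_self_eq_norm_sq_to_K, inner_self_eq_norm_sq_to_K,
        he.1 i]
      simp
    · intro j _ hj
      rw [TensorProduct.inner_tmul, he.2 (Ne.symm hj), mul_zero]
    · simp
  rw [← inner_self_eq_norm_sq (𝕜 := ℂ) (∑ i, x i ⊗ₜ[ℂ] e i), h, ← Complex.ofReal_sum]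
  rfl

lemma norm_rTensor_le (A : H →L[ℂ] H) (t : H ⊗[ℂ] K) :
    ‖TensorProduct.map (A : H →ₗ[ℂ] H) (LinearMap.id : K →ₗ[ℂ] K) t‖ ≤ ‖A‖ * ‖t‖ := by
  obtain ⟨m, x, e, he, rfl⟩ := exists_orthonormal_sum t
  have h1 : TensorProduct.map (A : H →ₗ[ℂ] H) (LinearMap.id : K →ₗ[ℂ] K)
      (∑ i, x i ⊗ₜ[ℂ] e i) = ∑ i, A (x i) ⊗ₜ[ℂ] e i := by simp [map_sum]
  rw [h1]
  refine le_of_sq_le_sq ?_ (by positivity)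
  rw [mul_pow, norm_sq_orthonormal_sum _ he, norm_sq_orthonormal_sum _ he, Finset.mul_sum]
  refine Finset.sum_le_sum fun i _ => ?_
  rw [← mul_pow]
  exact pow_le_pow_left₀ (norm_nonneg _) (A.le_opNorm _) 2

lemma norm_lTensor_le (B : K →L[ℂ] K) (t : H ⊗[ℂ] K) :
    ‖TensorProduct.map (LinearMap.id : H →ₗ[ℂ] H) (B : K →ₗ[ℂ] K) t‖ ≤ ‖B‖ * ‖t‖ := by
  have h := norm_rTensor_le (K := H) B (TensorProduct.comm ℂ H K t)
  have h0 := TensorProduct.norm_comm (𝕜 := ℂ) t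
  rw [h0] at h
  have h2 : TensorProduct.map (B : K →ₗ[ℂ] K) (LinearMap.id : H →ₗ[ℂ] H)
      (TensorProduct.comm ℂ H K t) = TensorProduct.comm ℂ H K
        (TensorProduct.map (LinearMap.id : H →ₗ[ℂ] H) (B : K →ₗ[ℂ] K) t) := by
    clear h h0
    induction t with
    | zero => simp
    | tmul a b => simp
    | add a b ha hb => simp only [map_add, ha, hb]
  rwa [h2, TensorProduct.norm_comm] at h

/-- The operator `A ⊗ B` on the algebraic tensor product. -/
def algTensor (A : H →L[ℂ] H) (B : K →L[ℂ] K) : H ⊗[ℂ] K →L[ℂ] H ⊗[ℂ] K :=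
  LinearMap.mkContinuous (TensorProduct.map (A : H →ₗ[ℂ] H) (B : K →ₗ[ℂ] K)) (‖A‖ * ‖B‖) (by
    intro t
    have h : TensorProduct.map (A : H →ₗ[ℂ] H) (B : K →ₗ[ℂ] K) t =
        TensorProduct.map (A : H →ₗ[ℂ] H) (LinearMap.id : K →ₗ[ℂ] K)
          (TensorProduct.map (LinearMap.id : H →ₗ[ℂ] H) (B : K →ₗ[ℂ] K) t) := by
      rw [← LinearMap.comp_apply, ← TensorProduct.map_comp, LinearMap.comp_id, LinearMap.id_comp]
    rw [h, mul_assoc]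
    exact (norm_rTensor_le A _).trans
      (mul_le_mul_of_nonneg_left (norm_lTensor_le B t) (norm_nonneg A)))

/-- The Hilbert space tensor product: the completion of the algebraic tensor product. -/
abbrev HTensor (H K : Type*) [NormedAddCommGroup H] [InnerProductSpace ℂ H]
    [NormedAddCommGroup K] [InnerProductSpace ℂ K] : Type _ :=
  Completion (H ⊗[ℂ] K)

/-- The product vector `f ⊗ g` in the Hilbert space tensor product. -/
def tensorVec (f : H) (g : K) : HTensor H K := ((f ⊗ₜ[ℂ] g : H ⊗[ℂ] K) : Completion (H ⊗[ℂ] K))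

/-- The bounded operator `A ⊗ B` on the Hilbert space tensor product. -/
def tensorOp (A : H →L[ℂ] H) (B : K →L[ℂ] K) : HTensor H K →L[ℂ] HTensor H K :=
  (algTensor A B).completion

lemma tensorOp_tensorVec (A : H →L[ℂ] H) (B : K →L[ℂ] K) (f : H) (g : K) :
    tensorOp A B (tensorVec f g) = tensorVec (A f) (B g) := by
  rw [tensorOp, tensorVec, ContinuousLinearMap.completion_apply_coe]
  rfl

end Tensor

/-! ### `n`-mode bosonic systems in the position representation -/

/-- Position space of `n` modes. -/
abbrev Pos (n : ℕ) : Type := EuclideanSpace ℝ (Fin n)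

/-- Complex phase space of `n` modes; its `volume` is the Lebesgue measure `d²ⁿα`. -/
abbrev Phase (n : ℕ) : Type := Fin n → ℂ

/-- The Hilbert space `L²(ℝⁿ)` of `n` modes. The mode operators are `aₖ = (xₖ + ∂ₖ) / √2`. -/
abbrev Mode (n : ℕ) : Type := Lp ℂ 2 (volume : Measure (Pos n))

/-- The position shift `√2 Re α`. -/
def posShift {n : ℕ} (α : Phase n) : Pos n := WithLp.toLp 2 fun k => √2 * (α k).re

/-- The momentum shift `√2 Im α`. -/
def momShift {n : ℕ} (α : Phase n) : Pos n := WithLp.toLp 2 fun k => √2 * (α k).im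

/-- With `q = √2 Re α` and `p = √2 Im α`, the function `x ↦ exp (i p·x - i p·q / 2) f (x - q)`. -/
def displacedFun {n : ℕ} (α : Phase n) (f : Pos n → ℂ) (x : Pos n) : ℂ :=
  Complex.exp (Complex.I *
    ((⟪momShift α, x⟫_ℝ - ⟪momShift α, posShift α⟫_ℝ / 2 : ℝ) : ℂ)) * f (x - posShift α)

section Displacement

variable {n : ℕ}

lemma norm_displacedFun (α : Phase n) (f : Pos n → ℂ) (x : Pos n) :
    ‖displacedFun α f x‖ = ‖f (x - posShift α)‖ := by
  rw [displacedFun, norm_mul, mul_comm Complex.I, Complex.norm_exp_ofReal_mul_I, one_mul]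

lemma aestronglyMeasurable_displacedFun (α : Phase n) {f : Pos n → ℂ}
    (hf : AEStronglyMeasurable f volume) :
    AEStronglyMeasurable (displacedFun α f) volume := by
  have h1 : AEStronglyMeasurable (fun x : Pos n => f (x - posShift α)) volume :=
    hf.comp_measurePreserving (measurePreserving_sub_right volume (posShift α))
  have h2 : Continuous fun x : Pos n => Complex.exp (Complex.I *
      ((⟪momShift α, x⟫_ℝ - ⟪momShift α, posShift α⟫_ℝ / 2 : ℝ) : ℂ)) := by fun_prop
  exact h2.aestronglyMeasurable.mul h1

lemma eLpNorm_displacedFun (α : Phase n) {f : Pos n → ℂ}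
    (hf : AEStronglyMeasurable f volume) :
    eLpNorm (displacedFun α f) 2 volume = eLpNorm f 2 volume := by
  rw [eLpNorm_congr_norm_ae (g := f ∘ fun x => x - posShift α)
    (Filter.Eventually.of_forall fun x => norm_displacedFun α f x)]
  exact eLpNorm_comp_measurePreserving hf (measurePreserving_sub_right volume (posShift α))

lemma memLp_displacedFun (α : Phase n) (f : Mode n) : MemLp (displacedFun α f) 2 volume := by
  refine ⟨aestronglyMeasurable_displacedFun α (Lp.aestronglyMeasurable f), ?_⟩
  rw [eLpNorm_displacedFun α (Lp.aestronglyMeasurable f)]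
  exact (Lp.memLp f).2

lemma displacedFun_congr (α : Phase n) {f g : Pos n → ℂ} (h : f =ᵐ[volume] g) :
    displacedFun α f =ᵐ[volume] displacedFun α g := by
  have h1 := (measurePreserving_sub_right volume (posShift α)).quasiMeasurePreserving.ae_eq_comp h
  filter_upwards [h1] with x hx
  simp only [Function.comp_apply] at hx
  rw [displacedFun, displacedFun, hx]

/-- The displacement operator `D(α) = exp (∑ₖ (αₖ aₖ† - αₖ* aₖ))`: as the exponent is
`i (p·x̂ - q·p̂)` with `q = √2 Re α` and `p = √2 Im α`, it acts as
`(D(α) f)(x) = exp (i p·x - i p·q / 2) f (x - q)`. -/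
def displacement (α : Phase n) : Mode n →L[ℂ] Mode n :=
  LinearMap.mkContinuous
    { toFun := fun f => (memLp_displacedFun α f).toLp
      map_add' := by
        intro f g
        refine Lp.ext ?_
        filter_upwards [(memLp_displacedFun α (f + g)).coeFn_toLp,
          displacedFun_congr α (Lp.coeFn_add f g),
          Lp.coeFn_add (memLp_displacedFun α f).toLp (memLp_displacedFun α g).toLp,
          (memLp_displacedFun α f).coeFn_toLp, (memLp_displacedFun α g).coeFn_toLp]
          with x h1 h2 h3 h4 h5
        rw [h1, h2, h3, Pi.add_apply, h4, h5]
        simp only [displacedFun, Pi.add_apply, mul_add]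
      map_smul' := by
        intro c f
        refine Lp.ext ?_
        filter_upwards [(memLp_displacedFun α (c • f)).coeFn_toLp,
          displacedFun_congr α (Lp.coeFn_smul c f),
          Lp.coeFn_smul c (memLp_displacedFun α f).toLp,
          (memLp_displacedFun α f).coeFn_toLp] with x h1 h2 h3 h4
        rw [h1, h2, RingHom.id_apply, h3, Pi.smul_apply, h4]
        simp only [displacedFun, Pi.smul_apply, smul_eq_mul]
        ring }
    1 (by
      intro f
      rw [one_mul]
      change ‖(memLp_displacedFun α f).toLp‖ ≤ ‖f‖
      rw [Lp.norm_toLp, eLpNorm_displacedFun α (Lp.aestronglyMeasurable f), Lp.norm_def])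

lemma displacement_ae (α : Phase n) (f : Mode n) :
    displacement α f =ᵐ[volume] displacedFun α f :=
  (memLp_displacedFun α f).coeFn_toLp

end Displacement

section States

variable {n : ℕ}

/-- The characteristic function `χ_ρ(α) = Tr[ρ D(α)]`. -/
def charFn (ρ : Mode n →L[ℂ] Mode n) (α : Phase n) : ℂ :=
  trace (ρ ∘L displacement α)

/-- `ρ'` is the reflected state `ρ^(U)` of `ρ`: the state with `χ_{ρ'}(α) = χ_ρ(U α*)`. -/
def IsReflectedState (U : Matrix (Fin n) (Fin n) ℂ) (ρ ρ' : Mode n →L[ℂ] Mode n) : Prop :=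
  IsDensityOperator ρ' ∧ ∀ α : Phase n, charFn ρ' α = charFn ρ (U.mulVec (star α))

/-- The unitary operator `𝒰` is the linear-optical circuit of the matrix `U`:
`𝒰† D(α) 𝒰 = D(Uᵀ α)` for all `α`. -/
def IsLinearOptical (U : Matrix (Fin n) (Fin n) ℂ) (𝒰 : Mode n ≃ₗᵢ[ℂ] Mode n) : Prop :=
  ∀ (α : Phase n) (f : Mode n),
    𝒰.symm (displacement α (𝒰 f)) = displacement (U.transpose.mulVec α) f

/-- The state `𝒰 ρ 𝒰†`. -/
def evolve (𝒰 : Mode n ≃ₗᵢ[ℂ] Mode n) (ρ : Mode n →L[ℂ] Mode n) : Mode n →L[ℂ] Mode n :=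
  𝒰.toContinuousLinearEquiv.toContinuousLinearMap ∘L ρ ∘L
    𝒰.symm.toContinuousLinearEquiv.toContinuousLinearMap

/-! ### The Bell measurement and its post-processing -/

/-- The amplitude `⟨Ψ| (I ⊗ D(ζ)†) |f ⊗ g⟩`, where `|Ψ⟩ = ∑ₖ |k⟩|k⟩` is the unnormalised maximally
entangled vector over the number basis. As the number states are real functions of position,
`⟨Ψ | f ⊗ g⟩ = ∫ f(x) g(x) dx`; and `D(ζ)† = D(-ζ)`. -/
def bellAmplitude (f g : Mode n) (ζ : Phase n) : ℂ :=
  ∫ x, f x * displacement (-ζ) g x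

/-- `E` is the continuous-variable Bell measurement, i.e. the POVM with the density
`Π(ζ) = π⁻ⁿ (I ⊗ D(ζ)) |Ψ⟩⟨Ψ| (I ⊗ D(ζ)†)` with respect to `d²ⁿζ`. As `|Ψ⟩` is not normalisable, the
density is a form on product vectors; these span a dense subspace, so that `E` is determined. -/
def IsBellMeasurement (E : POVM (Phase n) (HTensor (Mode n) (Mode n))) : Prop :=
  ∀ B : Set (Phase n), MeasurableSet B → ∀ f g f' g' : Mode n,
    IntegrableOn (fun ζ => star (bellAmplitude f g ζ) * bellAmplitude f' g' ζ) B ∧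
    ⟪tensorVec f g, E.effect B (tensorVec f' g')⟫_ℂ =
      ((Real.pi : ℂ) ^ n)⁻¹ * ∫ ζ in B, star (bellAmplitude f g ζ) * bellAmplitude f' g' ζ

/-- The estimate `N⁻¹ ∑ⱼ exp (-(ζⱼ·α - ζⱼ*·α*))` of `χ_ρ(α)²` from the outcomes `ζ₁, …, ζ_N`. -/
def estimateSq {N : ℕ} (ζ : Fin N → Phase n) (α : Phase n) : ℂ :=
  (N : ℂ)⁻¹ * ∑ j, Complex.exp (-(ζ j ⬝ᵥ α - star (ζ j) ⬝ᵥ star α))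

/-- The estimate of `χ_ρ(α)` up to a sign: the principal square root of the estimate of its square,
or zero when that one has modulus at most `2 ε² / 3`. -/
def estimate {N : ℕ} (ε : ℝ) (ζ : Fin N → Phase n) (α : Phase n) : ℂ :=
  if ‖estimateSq ζ α‖ ≤ 2 / 3 * ε ^ 2 then 0 else estimateSq ζ α ^ (1 / 2 : ℂ)

end States

end CVLearning

end

open CVLearning

/-!
The scheme rests on one identity of displacement operators. The vectors `(I ⊗ D(ζ)) |Ψ⟩` are
generalised eigenvectors of the commuting operators `D(α) ⊗ D(α*)`, with the eigenvalues
`exp (-(ζ·α - ζ*·α*))` (`bellAmplitude_displacement`). Hence the mean of this phase over the Bell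
outcomes for `ρ ⊗ σ` is `χ_ρ(α) χ_σ(α*)` (`integral_bellPhase`). For `σ = 𝒰 ρ^(U) 𝒰†` the second
factor is `χ_{ρ^(U)}(Uᵀ α*) = χ_ρ(U (Uᵀ α*)*) = χ_ρ(α)`, so that the phases have the mean `χ_ρ(α)²`
(`exists_outcomeLaw`). They have modulus one, so Hoeffding's inequality and a union bound give
`|v̂ᵢ - χ_ρ(αᵢ)²| ≤ ε² / 3` for all `i` with probability `1 - δ`; then the thresholded square root
is within `ε` of `± χ_ρ(αᵢ)`, because `(û - χ)(û + χ) = v̂ - χ²` (`min_norm_estimate_sub_le`).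

The objects of the statement are constructed as follows.

* Traces. A state is a sum of rank-one operators `|wⱼ⟩⟨wⱼ|` with `∑ ‖wⱼ‖² = 1`, and
  `Tr[ρ A] = ∑ ⟨wⱼ, A wⱼ⟩` for each such ensemble (`IsEnsemble.hasSum_trace`). Ensembles can be
  conjugated, transformed by unitaries and tensored, which makes all the traces below explicit sums.
* The Bell measurement. By Plancherel's and Tonelli's theorems, the amplitudes
  `π^(-n/2) ⟨Ψ| (I ⊗ D(ζ)†) |f ⊗ g⟩` have the norm `‖f‖ ‖g‖` in `L²(ℂⁿ)`
  (`lintegral_bellAmplitude_sq`). By polarization they define an isometry `V` from the tensor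
  product into `L²(ℂⁿ)`, and the effects are `V† 1_B V` (`POVM.ofIsometry`).
* The circuit. Quadratic phases implement momentum shears of phase space, their conjugates with the
  Fourier transform implement position shears. If `-1` is not an eigenvalue of the symmetric unitary
  matrix `A + i B`, then `A` and `B` are commuting symmetric matrices with `A² + B² = 1`, and the
  phase space rotation is a product of three shears, with `T = B (1 + A)⁻¹` as in
  `tan (θ / 2) = sin θ / (1 + cos θ)` (`exists_intertwines_of_shears`). The excluded eigenvalue is
  avoided by splitting off two scalar phases (`exists_intertwines`).
* The reflected state. Complex conjugation of a state turns `χ(α)` into `χ(-α*)`, and the circuit of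
  `-U` turns this into `χ(U α*)` (`exists_isReflectedState`).
-/

noncomputable section

namespace CVLearning

/-! ### Ensembles of vectors and the trace -/

section Ensembles

variable {H K : Type*} [NormedAddCommGroup H] [InnerProductSpace ℂ H]
  [NormedAddCommGroup K] [InnerProductSpace ℂ K]

/-- The operator `T` is the sum of the rank-one operators `|wⱼ⟩⟨wⱼ|`, where `∑ⱼ ‖wⱼ‖² < ∞`. The sum
is encoded weakly, through the matrix elements of `T`. -/
structure IsEnsemble {ι : Type*} (w : ι → H) (T : H →L[ℂ] H) : Prop where
  summable : Summable fun j => ‖w j‖ ^ 2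
  hasSum : ∀ x y, HasSum (fun j => ⟪x, w j⟫_ℂ * ⟪w j, y⟫_ℂ) ⟪x, T y⟫_ℂ

lemma hasSum_of_eq {ι : Type*} {f g : ι → ℂ} {a : ℂ} (h : HasSum f a) (e : ∀ i, g i = f i) :
    HasSum g a :=
  (funext e : g = f) ▸ h

lemma inner_self_eq_ofReal_norm_sq (x : H) : ⟪x, x⟫_ℂ = ((‖x‖ ^ 2 : ℝ) : ℂ) := by
  rw [inner_self_eq_norm_sq_to_K]
  push_cast
  rfl

lemma inner_mul_inner_swap (x y : H) : ⟪x, y⟫_ℂ * ⟪y, x⟫_ℂ = ((‖⟪x, y⟫_ℂ‖ ^ 2 : ℝ) : ℂ) := by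
  rw [← inner_conj_symm y x, Complex.mul_conj, Complex.normSq_eq_norm_sq]

lemma hasSum_norm_inner_sq {ι : Type*} (b : HilbertBasis ι ℂ H) (x : H) :
    HasSum (fun i => ‖⟪b i, x⟫_ℂ‖ ^ 2) (‖x‖ ^ 2) := by
  have h := b.hasSum_inner_mul_inner x x
  simp only [inner_mul_inner_swap, inner_self_eq_ofReal_norm_sq] at h
  simpa only [norm_inner_symm] using Complex.hasSum_ofReal.1 h

lemma summable_prod_norm_inner_sq {ι κ : Type*} (b : HilbertBasis ι ℂ H) {v : κ → H}
    (hv : Summable fun j => ‖v j‖ ^ 2) :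
    Summable fun p : κ × ι => ‖⟪b p.2, v p.1⟫_ℂ‖ ^ 2 := by
  refine (summable_prod_of_nonneg fun p => by positivity).2
    ⟨fun j => (hasSum_norm_inner_sq b (v j)).summable, ?_⟩
  simpa only [(hasSum_norm_inner_sq b _).tsum_eq] using hv

variable [CompleteSpace H] [CompleteSpace K]

/-- The trace of `T A` in terms of an ensemble of `T`: both sides are iterated sums of one
absolutely summable double family. -/
lemma IsEnsemble.hasSum_trace {ι : Type*} {w : ι → H} {T : H →L[ℂ] H} (h : IsEnsemble w T)
    (A : H →L[ℂ] H) : HasSum (fun j => ⟪w j, A (w j)⟫_ℂ) (trace (T ∘L A)) := by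
  set b := refBasis H
  let B := ContinuousLinearMap.adjoint A
  have hB : Summable fun j => ‖B (w j)‖ ^ 2 := by
    refine Summable.of_nonneg_of_le (fun _ => by positivity) (fun j => ?_)
      (h.summable.mul_left (‖B‖ ^ 2))
    rw [← mul_pow]
    exact pow_le_pow_left₀ (norm_nonneg _) (B.le_opNorm _) 2
  let F : ι → basisIndex H → ℂ := fun j i => ⟪b i, w j⟫_ℂ * ⟪w j, A (b i)⟫_ℂ
  have hF : Summable fun p : ι × basisIndex H => F p.1 p.2 := by
    refine Summable.of_norm_bounded
      ((summable_prod_norm_inner_sq b h.summable).add (summable_prod_norm_inner_sq b hB)) ?_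
    intro p
    have e : ‖⟪w p.1, A (b p.2)⟫_ℂ‖ = ‖⟪b p.2, B (w p.1)⟫_ℂ‖ := by
      rw [← ContinuousLinearMap.adjoint_inner_left, norm_inner_symm]
    change ‖_ * _‖ ≤ _
    rw [norm_mul, e]
    nlinarith [sq_nonneg (‖⟪b p.2, w p.1⟫_ℂ‖ - ‖⟪b p.2, B (w p.1)⟫_ℂ‖),
      sq_nonneg (‖⟪b p.2, w p.1⟫_ℂ‖), sq_nonneg (‖⟪b p.2, B (w p.1)⟫_ℂ‖)]
  have h1 : HasSum (fun p : ι × basisIndex H => F p.1 p.2) (trace (T ∘L A)) := by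
    have hF' : Summable fun p : basisIndex H × ι => F p.2 p.1 := hF.prod_symm
    have h2 : (∑' p : basisIndex H × ι, F p.2 p.1) = trace (T ∘L A) := by
      rw [Summable.tsum_prod' hF' fun i => (h.hasSum (b i) (A (b i))).summable]
      exact tsum_congr fun i => (h.hasSum (b i) (A (b i))).tsum_eq
    rw [← h2]
    exact (Equiv.prodComm ι (basisIndex H)).symm.hasSum_iff.1 hF'.hasSum
  refine h1.prod_fiberwise fun j => ?_
  have h3 := b.hasSum_inner_mul_inner (B (w j)) (w j)
  simp only [B, ContinuousLinearMap.adjoint_inner_left] at h3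
  exact hasSum_of_eq h3 fun i => mul_comm (⟪b i, w j⟫_ℂ) (⟪w j, A (b i)⟫_ℂ)

/-- The vectors `√ρ eᵢ`, with an orthonormal basis `eᵢ`, form an ensemble of `ρ`. -/
lemma IsDensityOperator.exists_isEnsemble {ρ : H →L[ℂ] H} (h : IsDensityOperator ρ) :
    ∃ w : basisIndex H → H, IsEnsemble w ρ := by
  have h0 : 0 ≤ ρ := (ContinuousLinearMap.nonneg_iff_isPositive ρ).2 h.1
  set S := CFC.sqrt ρ
  have hS : ∀ x y, ⟪S x, y⟫_ℂ = ⟪x, S y⟫_ℂ := by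
    have h1 : IsSelfAdjoint S := (CFC.sqrt_nonneg ρ).isSelfAdjoint
    exact fun x y => (h1.isSymmetric) x y
  have hSS : ∀ y, ρ y = S (S y) := fun y => by
    conv_lhs => rw [← CFC.sqrt_mul_sqrt_self ρ h0]
    rfl
  set b := refBasis H
  refine ⟨fun i => S (b i), ?_, fun x y => ?_⟩
  · have h1 : Summable fun i => ⟪b i, ρ (b i)⟫_ℂ := by
      by_contra hc
      have := h.2
      rw [trace, tsum_eq_zero_of_not_summable hc] at this
      exact zero_ne_one this
    have h2 := (Complex.hasSum_re h1.hasSum).summable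
    convert h2 using 2 with i
    rw [hSS, ← hS, inner_self_eq_ofReal_norm_sq, Complex.ofReal_re]
  · have h1 := b.hasSum_inner_mul_inner (S x) (S y)
    rw [hS x (S y), ← hSS] at h1
    simpa only [hS] using h1

lemma IsEnsemble.isDensityOperator {ι : Type*} {w : ι → H} {T : H →L[ℂ] H}
    (hT : IsEnsemble w T) (hw : HasSum (fun j => ‖w j‖ ^ 2) 1) : IsDensityOperator T := by
  constructor
  · refine (ContinuousLinearMap.isPositive_iff_complex T).2 fun x => ?_
    have h1 := hT.hasSum x x
    simp only [inner_mul_inner_swap] at h1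
    have h2 := (Complex.hasSum_ofReal.2 (Complex.hasSum_re h1)).unique h1
    have h3 : 0 ≤ (⟪x, T x⟫_ℂ).re := (Complex.hasSum_re h1).nonneg fun j => by
      rw [Complex.ofReal_re]; positivity
    rw [← inner_conj_symm (T x) x]
    refine ⟨?_, h3⟩
    conv_rhs => rw [← h2, Complex.conj_ofReal]
    rw [← h2, Complex.conj_ofReal]
    rfl
  · have h1 := hT.hasSum_trace 1
    have h2 : HasSum (fun j => ⟪w j, (1 : H →L[ℂ] H) (w j)⟫_ℂ) ((1 : ℝ) : ℂ) := by
      convert Complex.hasSum_ofReal.2 hw using 2 with j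
      exact inner_self_eq_ofReal_norm_sq _
    exact (h1.unique h2).trans Complex.ofReal_one

/-- Every square-summable family is an ensemble: the rank-one operators are summable in norm. -/
lemma exists_isEnsemble {ι : Type*} {w : ι → H} (hw : Summable fun j => ‖w j‖ ^ 2) :
    ∃ T : H →L[ℂ] H, IsEnsemble w T := by
  have hs : Summable fun j => InnerProductSpace.rankOne ℂ (w j) (w j) := by
    refine Summable.of_norm ?_
    simpa only [InnerProductSpace.norm_rankOne, ← sq] using hw
  refine ⟨∑' j, InnerProductSpace.rankOne ℂ (w j) (w j), hw, fun x y => ?_⟩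
  have h1 := (hs.hasSum.mapL (ContinuousLinearMap.apply ℂ H y)).mapL (innerSL ℂ x)
  refine hasSum_of_eq h1 fun j => ?_
  change _ = ⟪x, InnerProductSpace.rankOne ℂ (w j) (w j) y⟫_ℂ
  rw [InnerProductSpace.rankOne_apply, inner_smul_right, mul_comm]

lemma IsEnsemble.hasSum_norm_sq {ι : Type*} {w : ι → H} {ρ : H →L[ℂ] H} (h : IsEnsemble w ρ)
    (hρ : IsDensityOperator ρ) : HasSum (fun j => ‖w j‖ ^ 2) 1 := by
  have h1 := Complex.hasSum_re (h.hasSum_trace 1)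
  have h2 : ρ ∘L 1 = ρ := rfl
  rw [h2, hρ.2] at h1
  convert h1 using 2 with j
  · exact (congrArg Complex.re (inner_self_eq_ofReal_norm_sq (w j))).symm
  · exact Complex.one_re.symm

end Ensembles

section TensorEnsembles

lemma hasSum_mul_prod {ι κ : Type*} {f : ι → ℂ} {g : κ → ℂ} {a b : ℂ} (hf : HasSum f a)
    (hg : HasSum g b) : HasSum (fun p : ι × κ => f p.1 * g p.2) (a * b) :=
  hf.mul hg (summable_mul_of_summable_norm hf.summable.norm hg.summable.norm)

variable {H K : Type*} [NormedAddCommGroup H] [InnerProductSpace ℂ H]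
  [NormedAddCommGroup K] [InnerProductSpace ℂ K]

@[simp]
lemma inner_tensorVec (f f' : H) (g g' : K) :
    ⟪tensorVec f g, tensorVec f' g'⟫_ℂ = ⟪f, f'⟫_ℂ * ⟪g, g'⟫_ℂ := by
  rw [tensorVec, tensorVec, Completion.inner_coe, TensorProduct.inner_tmul]

@[simp]
lemma norm_tensorVec (f : H) (g : K) : ‖tensorVec f g‖ = ‖f‖ * ‖g‖ := by
  rw [tensorVec, Completion.norm_coe, TensorProduct.norm_tmul]

/-- Product vectors are total in the tensor product. -/
lemma HTensor.clm_ext {E : Type*} [NormedAddCommGroup E] [NormedSpace ℂ E]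
    {S T : HTensor H K →L[ℂ] E} (h : ∀ f g, S (tensorVec f g) = T (tensorVec f g)) : S = T := by
  ext t
  refine Completion.induction_on t (isClosed_eq S.continuous T.continuous) fun t => ?_
  induction t with
  | zero => rw [Completion.coe_zero, map_zero, map_zero]
  | tmul f g => exact h f g
  | add a b ha hb => rw [Completion.coe_add, map_add, map_add, ha, hb]

lemma HTensor.eq_of_inner_tensorVec {s t : HTensor H K}
    (h : ∀ f g, ⟪s, tensorVec f g⟫_ℂ = ⟪t, tensorVec f g⟫_ℂ) : s = t := by
  have h1 : innerSL ℂ s = innerSL ℂ t := HTensor.clm_ext h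
  refine ext_inner_right ℂ fun v => ?_
  exact congrArg (fun L => L v) h1

lemma IsEnsemble.tensor {ι κ : Type*} {w : ι → H} {z : κ → K} {S : H →L[ℂ] H} {T : K →L[ℂ] K}
    (hS : IsEnsemble w S) (hT : IsEnsemble z T) :
    IsEnsemble (fun p : ι × κ => tensorVec (w p.1) (z p.2)) (tensorOp S T) := by
  have h1 : Summable fun p : ι × κ => ‖tensorVec (w p.1) (z p.2)‖ ^ 2 := by
    simpa only [norm_tensorVec, mul_pow] using
      hS.summable.mul_of_nonneg hT.summable (fun _ => sq_nonneg _) (fun _ => sq_nonneg _)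
  obtain ⟨R, hR⟩ := exists_isEnsemble (H := HTensor H K) h1
  have key : tensorOp S T = R := by
    refine HTensor.clm_ext fun f g => ?_
    rw [tensorOp_tensorVec]
    refine HTensor.eq_of_inner_tensorVec fun f' g' => ?_
    rw [← inner_conj_symm, ← inner_conj_symm (R (tensorVec f g))]
    congr 1
    rw [inner_tensorVec]
    have h4 := hS.hasSum f' f
    have h5 := hT.hasSum g' g
    have h6 := hR.hasSum (tensorVec f' g') (tensorVec f g)
    simp only [inner_tensorVec] at h6
    refine HasSum.unique ?_ h6
    refine hasSum_of_eq (hasSum_mul_prod h4 h5) fun p => ?_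
    ring
  rw [key]
  exact hR

end TensorEnsembles

/-! ### Displacement operators and complex conjugation -/

section DisplacementAlgebra

variable {n : ℕ}

@[simp]
lemma posShift_neg (α : Phase n) : posShift (-α) = -posShift α := by
  ext k
  simp [posShift]

@[simp]
lemma momShift_neg (α : Phase n) : momShift (-α) = -momShift α := by
  ext k
  simp [momShift]

@[simp]
lemma posShift_star (α : Phase n) : posShift (star α) = posShift α := by
  ext k
  simp [posShift]

@[simp]
lemma momShift_star (α : Phase n) : momShift (star α) = -momShift α := by
  ext k
  simp [momShift]

lemma norm_displacement (α : Phase n) (f : Mode n) : ‖displacement α f‖ = ‖f‖ := by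
  change ‖(memLp_displacedFun α f).toLp‖ = ‖f‖
  rw [Lp.norm_toLp, eLpNorm_displacedFun α (Lp.aestronglyMeasurable f), Lp.norm_def]

lemma displacement_displacement_ae (α β : Phase n) (f : Mode n) :
    displacement α (displacement β f) =ᵐ[volume] displacedFun α (displacedFun β f) :=
  (displacement_ae α _).trans (displacedFun_congr α (displacement_ae β f))

lemma displacement_neg_displacement (α : Phase n) (f : Mode n) :
    displacement (-α) (displacement α f) = f := by
  refine Lp.ext ?_
  filter_upwards [displacement_displacement_ae (-α) α f] with x hx
  rw [hx]
  simp only [displacedFun, posShift_neg, momShift_neg, sub_neg_eq_add, add_sub_cancel_right]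
  rw [← mul_assoc, ← Complex.exp_add]
  simp only [inner_neg_left, inner_neg_right, inner_add_right]
  push_cast
  ring_nf
  simp

lemma displacement_displacement_neg (α : Phase n) (f : Mode n) :
    displacement α (displacement (-α) f) = f := by
  simpa using displacement_neg_displacement (-α) f

lemma inner_displacement_displacement (α : Phase n) (f g : Mode n) :
    ⟪displacement α f, displacement α g⟫_ℂ = ⟪f, g⟫_ℂ :=
  LinearIsometry.inner_map_map
    ⟨(displacement α : Mode n →ₗ[ℂ] Mode n), norm_displacement α⟩ f g

lemma inner_displacement_left (α : Phase n) (f g : Mode n) :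
    ⟪displacement α f, g⟫_ℂ = ⟪f, displacement (-α) g⟫_ℂ := by
  rw [← inner_displacement_displacement α f, displacement_displacement_neg]

lemma symplectic_phase (α β : Phase n) :
    Complex.I * ((⟪momShift α, posShift β⟫_ℝ - ⟪momShift β, posShift α⟫_ℝ : ℝ) : ℂ) =
      α ⬝ᵥ star β - star α ⬝ᵥ β := by
  simp only [posShift, momShift, PiLp.inner_apply, dotProduct, ← Finset.sum_sub_distrib]
  push_cast
  rw [Finset.mul_sum]
  refine Finset.sum_congr rfl fun k _ => ?_
  have h2 : (√2 : ℝ) * √2 = 2 := Real.mul_self_sqrt (by norm_num)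
  apply Complex.ext
  · simp
  · simp
    linear_combination ((α k).im * (β k).re - (β k).im * (α k).re) * h2

/-- The Weyl commutation relation. -/
lemma displacement_comm (α β : Phase n) (f : Mode n) :
    displacement α (displacement β f) =
      Complex.exp (α ⬝ᵥ star β - star α ⬝ᵥ β) • displacement β (displacement α f) := by
  refine Lp.ext ?_
  filter_upwards [displacement_displacement_ae α β f, displacement_displacement_ae β α f,
    Lp.coeFn_smul (Complex.exp (α ⬝ᵥ star β - star α ⬝ᵥ β)) (displacement β (displacement α f))]
    with x h1 h2 h3
  rw [h1, h3, Pi.smul_apply, h2, smul_eq_mul, ← symplectic_phase]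
  simp only [displacedFun]
  rw [← mul_assoc, ← mul_assoc, ← mul_assoc, ← Complex.exp_add, ← Complex.exp_add,
    ← Complex.exp_add, sub_right_comm x]
  congr 2
  simp only [inner_sub_right]
  push_cast
  ring

lemma star_displacement (α : Phase n) (f : Mode n) :
    star (displacement α f) = displacement (star α) (star f) := by
  refine Lp.ext ?_
  filter_upwards [Lp.coeFn_star (displacement α f), displacement_ae α f,
    displacement_ae (star α) (star f), displacedFun_congr (star α) (Lp.coeFn_star f)]
    with x h1 h2 h3 h4
  rw [h1, h3, h4, Pi.star_apply, h2]
  simp only [displacedFun, Pi.star_apply, star_mul', posShift_star, momShift_star]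
  congr 1
  rw [Complex.star_def, ← Complex.exp_conj, map_mul, Complex.conj_I, Complex.conj_ofReal]
  simp only [inner_neg_left]
  push_cast
  ring_nf

lemma inner_star_star (f g : Mode n) : ⟪star f, star g⟫_ℂ = ⟪g, f⟫_ℂ := by
  rw [L2.inner_def, L2.inner_def]
  refine integral_congr_ae ?_
  filter_upwards [Lp.coeFn_star f, Lp.coeFn_star g] with x h1 h2
  simp [h1, h2, mul_comm]

lemma norm_star_mode (f : Mode n) : ‖star f‖ = ‖f‖ := by
  have h := inner_star_star f f
  rw [inner_self_eq_ofReal_norm_sq, inner_self_eq_ofReal_norm_sq, Complex.ofReal_inj] at h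
  exact (pow_left_inj₀ (norm_nonneg _) (norm_nonneg _) two_ne_zero).1 h

lemma star_mode_add (f g : Mode n) : star (f + g) = star f + star g := by
  refine Lp.ext ?_
  filter_upwards [Lp.coeFn_star (f + g), Lp.coeFn_add f g, Lp.coeFn_add (star f) (star g),
    Lp.coeFn_star f, Lp.coeFn_star g] with x h1 h2 h3 h4 h5
  rw [h1, h3, Pi.star_apply, Pi.add_apply, h2, h4, h5, Pi.add_apply, star_add, Pi.star_apply,
    Pi.star_apply]

lemma star_mode_smul (c : ℂ) (f : Mode n) : star (c • f) = star c • star f := by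
  refine Lp.ext ?_
  filter_upwards [Lp.coeFn_star (c • f), Lp.coeFn_smul c f, Lp.coeFn_smul (star c) (star f),
    Lp.coeFn_star f] with x h1 h2 h3 h4
  rw [h1, h3, Pi.star_apply, Pi.smul_apply, h2, h4, Pi.smul_apply, star_smul, Pi.star_apply]

end DisplacementAlgebra

/-! ### The Fourier transform of integrable square-integrable functions -/

section Fourier

open FourierTransform SchwartzMap
open scoped ContDiff

variable {V : Type*} [NormedAddCommGroup V] [InnerProductSpace ℝ V] [FiniteDimensional ℝ V]
  [MeasurableSpace V] [BorelSpace V]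

/-- On integrable functions, the `L²` Fourier transform is the Fourier integral: both define the
same tempered distribution. -/
lemma coeFn_fourier {f : Lp ℂ 2 (volume : Measure V)} (hf : Integrable f) :
    ⇑(𝓕 f : Lp ℂ 2 (volume : Measure V)) =ᵐ[volume] 𝓕 (f : V → ℂ) := by
  refine ae_eq_of_integral_contDiff_smul_eq ((Lp.memLp _).locallyIntegrable one_le_two)
    (VectorFourier.fourierIntegral_continuous Real.continuous_fourierChar
      continuous_inner hf).locallyIntegrable fun g hg1 hg2 => ?_
  have hg₁ : HasCompactSupport (Complex.ofRealCLM ∘ g) := hg2.comp_left rfl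
  have hg₂ : ContDiff ℝ ∞ (Complex.ofRealCLM ∘ g) := by fun_prop
  let gS : 𝓢(V, ℂ) := hg₁.toSchwartzMap hg₂
  have h1 := congrArg (fun T : 𝓢'(V, ℂ) => T gS) (Lp.fourier_toTemperedDistribution_eq f)
  simp only [TemperedDistribution.fourier_apply, Lp.toTemperedDistribution_apply] at h1
  have h2 := VectorFourier.integral_fourierIntegral_smul_eq_flip (L := innerₗ V)
      Real.continuous_fourierChar continuous_inner (gS.integrable (μ := volume)) hf
  rw [flip_innerₗ] at h2
  have h3 : ∀ x, gS x = (g x : ℂ) := fun x => rfl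
  have h4 : ∀ x, 𝓕 gS x = VectorFourier.fourierIntegral 𝐞 volume (innerₗ V) gS x := fun x => rfl
  simp only [h3, h4] at h1 h2
  rw [h2] at h1
  exact h1.symm

/-- Plancherel's theorem for functions in `L¹ ∩ L²`. -/
lemma lintegral_fourier_sq {h : V → ℂ} (h1 : Integrable h) (h2 : MemLp h 2) :
    ∫⁻ ξ, ‖𝓕 h ξ‖ₑ ^ 2 = ∫⁻ x, ‖h x‖ₑ ^ 2 := by
  have e1 : Integrable (h2.toLp h) := h1.congr h2.coeFn_toLp.symm
  have e2 : 𝓕 (h2.toLp h : V → ℂ) = 𝓕 h := by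
    ext ξ
    rw [Real.fourier_eq, Real.fourier_eq]
    refine integral_congr_ae ?_
    filter_upwards [h2.coeFn_toLp] with x hx
    rw [hx]
  have e3 : eLpNorm (𝓕 h) 2 volume = eLpNorm h 2 volume := by
    have h3 := Lp.norm_fourier_eq (h2.toLp h)
    rw [Lp.norm_def, Lp.norm_def, eLpNorm_congr_ae (coeFn_fourier e1), e2,
      eLpNorm_congr_ae h2.coeFn_toLp] at h3
    refine (ENNReal.toReal_eq_toReal_iff' ?_ h2.2.ne).1 h3
    rw [← e2, ← eLpNorm_congr_ae (coeFn_fourier e1)]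
    exact (Lp.memLp _).2.ne
  have e4 := congrArg (· ^ (2 : ℝ)) e3
  simp only [eLpNorm_eq_lintegral_rpow_enorm_toReal two_ne_zero ENNReal.ofNat_ne_top,
    ENNReal.toReal_ofNat, one_div] at e4
  rw [← ENNReal.rpow_mul, ← ENNReal.rpow_mul] at e4
  simpa using e4

end Fourier

/-! ### Linear-optical circuits -/

section LinearOptics

open FourierTransform

variable {n : ℕ}

/-- The phase space point `(q + i p) / √2` with position shift `q` and momentum shift `p`. -/
def toPhase (q p : Pos n) : Phase n := fun k => ((q k : ℂ) + Complex.I * p k) / (√2 : ℝ)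

@[simp]
lemma posShift_toPhase (q p : Pos n) : posShift (toPhase q p) = q := by
  ext k
  simp only [posShift, toPhase, Complex.div_ofReal_re]
  simp
  field_simp

@[simp]
lemma momShift_toPhase (q p : Pos n) : momShift (toPhase q p) = p := by
  ext k
  simp only [momShift, toPhase, Complex.div_ofReal_im]
  simp
  field_simp

lemma toPhase_posShift_momShift (α : Phase n) : toPhase (posShift α) (momShift α) = α := by
  have h : ((√2 : ℝ) : ℂ) ≠ 0 := by simp
  ext k
  simp only [posShift, momShift, toPhase]
  rw [div_eq_iff h]
  push_cast
  linear_combination (√2 : ℝ) * Complex.re_add_im (α k)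

/-- The unitary `𝒱` implements the transformation `S` of phase space: `𝒱 D(α) 𝒱† = D(S α)`. -/
def Intertwines (𝒱 : Mode n ≃ₗᵢ[ℂ] Mode n) (S : Phase n → Phase n) : Prop :=
  ∀ (α : Phase n) (f : Mode n), 𝒱 (displacement α f) = displacement (S α) (𝒱 f)

lemma Intertwines.trans {𝒱 𝒲 : Mode n ≃ₗᵢ[ℂ] Mode n} {S T : Phase n → Phase n}
    (hV : Intertwines 𝒱 S) (hW : Intertwines 𝒲 T) : Intertwines (𝒱.trans 𝒲) (T ∘ S) := by
  intro α f
  simp only [LinearIsometryEquiv.trans_apply, hV α f, hW (S α), Function.comp_apply]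

/-- The Fourier transform exchanges position and momentum, up to the factor `2π`. -/
lemma fourier_displacedFun (q p : Pos n) (f : Pos n → ℂ) (ξ : Pos n) :
    𝓕 (displacedFun (toPhase q p) f) ξ =
      displacedFun (toPhase ((2 * Real.pi)⁻¹ • p) (-(2 * Real.pi) • q)) (𝓕 f) ξ := by
  simp only [displacedFun, posShift_toPhase, momShift_toPhase, Real.fourier_eq']
  rw [← integral_const_mul, ← integral_add_right_eq_self _ q]
  refine integral_congr_ae (Filter.Eventually.of_forall fun x => ?_)
  simp only [smul_eq_mul, add_sub_cancel_right]
  rw [← mul_assoc, ← mul_assoc, ← Complex.exp_add, ← Complex.exp_add]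
  congr 2
  simp only [inner_add_left, inner_add_right, inner_sub_right, inner_smul_left, inner_smul_right,
    real_inner_comm q p, real_inner_comm p x]
  have hpi : (Real.pi : ℂ) ≠ 0 := by exact_mod_cast Real.pi_ne_zero
  push_cast
  simp
  field_simp
  ring

lemma fourier_displacement (q p : Pos n) (f : Mode n) :
    𝓕 (displacement (toPhase q p) f) =
      displacement (toPhase ((2 * Real.pi)⁻¹ • p) (-(2 * Real.pi) • q)) (𝓕 f) := by
  -- both sides are continuous in `f`, so that Schwartz functions suffice
  refine DenseRange.induction_on
    (SchwartzMap.denseRange_toLpCLM (E := Pos n) (F := ℂ) (μ := volume) (p := 2)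
      ENNReal.ofNat_ne_top) f ?_ fun g => ?_
  · exact isClosed_eq
      ((Lp.fourierTransformₗᵢ (Pos n) ℂ).continuous.comp (displacement _).continuous)
      ((displacement _).continuous.comp (Lp.fourierTransformₗᵢ (Pos n) ℂ).continuous)
  · set f : Mode n := SchwartzMap.toLpCLM ℂ ℂ 2 volume g
    have hf : f =ᵐ[volume] g := g.coeFn_toLp 2 volume
    have h1 : Integrable f := g.integrable.congr hf.symm
    have h2 : Integrable (displacement (toPhase q p) f) := by
      refine Integrable.congr ?_ (displacement_ae _ _).symm
      rw [← integrable_norm_iff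
        (aestronglyMeasurable_displacedFun _ (Lp.aestronglyMeasurable f))]
      simp only [norm_displacedFun]
      exact (h1.comp_sub_right _).norm
    refine Lp.ext ?_
    have h3 : 𝓕 (displacement (toPhase q p) f : Pos n → ℂ) =
        𝓕 (displacedFun (toPhase q p) f) := by
      ext ξ
      rw [Real.fourier_eq, Real.fourier_eq]
      refine integral_congr_ae ?_
      filter_upwards [displacement_ae (toPhase q p) f] with x hx
      rw [hx]
    refine (coeFn_fourier h2).trans ?_
    rw [h3, funext (fourier_displacedFun q p f)]
    exact ((displacement_ae _ _).trans (displacedFun_congr _ (coeFn_fourier h1))).symm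

/-- The multiplication operator with the function `exp (i φ)` of modulus one. -/
def phaseMul (φ : C(Pos n, ℝ)) (f : Mode n) : Mode n :=
  MemLp.toLp (fun x => Complex.exp (Complex.I * (φ x : ℂ)) * f x) <| by
    refine (memLp_congr_norm ?_ (Lp.aestronglyMeasurable f) ?_).2 (Lp.memLp f)
    · have h : Continuous fun x => Complex.exp (Complex.I * (φ x : ℂ)) := by fun_prop
      exact h.aestronglyMeasurable.mul (Lp.aestronglyMeasurable f)
    · refine Filter.Eventually.of_forall fun x => ?_
      rw [norm_mul, mul_comm Complex.I, Complex.norm_exp_ofReal_mul_I, one_mul]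

lemma phaseMul_ae (φ : C(Pos n, ℝ)) (f : Mode n) :
    phaseMul φ f =ᵐ[volume] fun x => Complex.exp (Complex.I * (φ x : ℂ)) * f x :=
  MemLp.coeFn_toLp _

lemma phaseMul_neg_phaseMul (φ : C(Pos n, ℝ)) (f : Mode n) : phaseMul (-φ) (phaseMul φ f) = f := by
  refine Lp.ext ?_
  filter_upwards [phaseMul_ae (-φ) (phaseMul φ f), phaseMul_ae φ f] with x h1 h2
  rw [h1, h2, ← mul_assoc, ← Complex.exp_add]
  simp

/-- Multiplication with `exp (i φ)` as a unitary operator. -/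
def phaseUnitary (φ : C(Pos n, ℝ)) : Mode n ≃ₗᵢ[ℂ] Mode n where
  toFun := phaseMul φ
  invFun := phaseMul (-φ)
  map_add' f g := by
    refine Lp.ext ?_
    filter_upwards [phaseMul_ae φ (f + g), phaseMul_ae φ f, phaseMul_ae φ g, Lp.coeFn_add f g,
      Lp.coeFn_add (phaseMul φ f) (phaseMul φ g)] with x h1 h2 h3 h4 h5
    rw [h1, h5, Pi.add_apply, h2, h3, h4, Pi.add_apply, mul_add]
  map_smul' c f := by
    refine Lp.ext ?_
    filter_upwards [phaseMul_ae φ (c • f), phaseMul_ae φ f, Lp.coeFn_smul c f,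
      Lp.coeFn_smul c (phaseMul φ f)] with x h1 h2 h3 h4
    rw [h1, RingHom.id_apply, h4, Pi.smul_apply, h2, h3, Pi.smul_apply, smul_eq_mul, smul_eq_mul]
    ring
  left_inv := phaseMul_neg_phaseMul φ
  right_inv f := by simpa using phaseMul_neg_phaseMul (-φ) f
  norm_map' f := by
    change ‖phaseMul φ f‖ = ‖f‖
    rw [Lp.norm_def, Lp.norm_def]
    congr 1
    refine eLpNorm_congr_norm_ae ?_
    filter_upwards [phaseMul_ae φ f] with x hx
    rw [hx, norm_mul, mul_comm Complex.I, Complex.norm_exp_ofReal_mul_I, one_mul]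

/-- A real quadratic phase `exp (i ⟨x, P x⟩ / 2)` implements the momentum shear
`(q, p) ↦ (q, p + P q)`. -/
lemma exists_intertwines_momentum_shear (P : Pos n →ₗ[ℝ] Pos n) (hP : P.IsSymmetric) :
    ∃ 𝒱 : Mode n ≃ₗᵢ[ℂ] Mode n, ∀ q p f,
      𝒱 (displacement (toPhase q p) f) = displacement (toPhase q (p + P q)) (𝒱 f) := by
  have hc : Continuous P := P.continuous_of_finiteDimensional
  let φ : C(Pos n, ℝ) := ⟨fun x => ⟪x, P x⟫_ℝ / 2, by fun_prop⟩
  refine ⟨phaseUnitary φ, fun q p f => ?_⟩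
  change phaseMul φ _ = displacement _ (phaseMul φ f)
  refine Lp.ext ?_
  filter_upwards [phaseMul_ae φ (displacement (toPhase q p) f),
    displacement_ae (toPhase q p) f, displacement_ae (toPhase q (p + P q)) (phaseMul φ f),
    displacedFun_congr (toPhase q (p + P q)) (phaseMul_ae φ f)] with x h1 h2 h3 h4
  rw [h1, h2, h3, h4]
  simp only [displacedFun, posShift_toPhase, momShift_toPhase, φ, ContinuousMap.coe_mk]
  rw [← mul_assoc, ← mul_assoc, ← Complex.exp_add, ← Complex.exp_add]
  congr 2
  simp only [map_sub, inner_sub_left, inner_sub_right, inner_add_left]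
  have e1 : ⟪x, P q⟫_ℝ = ⟪P q, x⟫_ℝ := real_inner_comm _ _
  have e2 : ⟪q, P x⟫_ℝ = ⟪P q, x⟫_ℝ := (hP q x).symm
  have e3 : ⟪q, P q⟫_ℝ = ⟪P q, q⟫_ℝ := (hP q q).symm
  rw [e1, e2, e3]
  push_cast
  ring

/-- Conjugating a momentum shear with the Fourier transform gives a position shear. -/
lemma exists_intertwines_position_shear (T : Pos n →ₗ[ℝ] Pos n) (hT : T.IsSymmetric) :
    ∃ 𝒱 : Mode n ≃ₗᵢ[ℂ] Mode n, ∀ q p f,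
      𝒱 (displacement (toPhase q p) f) = displacement (toPhase (q - T p) p) (𝒱 f) := by
  obtain ⟨𝒢, h𝒢⟩ := exists_intertwines_momentum_shear (((2 * Real.pi) ^ 2) • T)
    (hT.smul (by simp))
  let ℱ := Lp.fourierTransformₗᵢ (Pos n) ℂ
  have hF : ∀ (q p : Pos n) (f : Mode n), ℱ (displacement (toPhase q p) f) =
      displacement (toPhase ((2 * Real.pi)⁻¹ • p) (-(2 * Real.pi) • q)) (ℱ f) :=
    fourier_displacement
  refine ⟨(ℱ.trans 𝒢).trans ℱ.symm, fun q p f => ?_⟩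
  simp only [LinearIsometryEquiv.trans_apply]
  rw [LinearIsometryEquiv.symm_apply_eq, hF, hF, h𝒢, LinearIsometryEquiv.apply_symm_apply]
  congr 3
  have hpi : (2 * Real.pi) ^ 2 * (2 * Real.pi)⁻¹ = 2 * Real.pi := by
    have := Real.pi_ne_zero
    field_simp
  rw [LinearMap.smul_apply, map_smul, smul_smul, hpi]
  module

end LinearOptics

section SymmetricUnitary

variable {n : ℕ}

lemma mulVec_toPhase (V : Matrix (Fin n) (Fin n) ℂ) (q p : Pos n) :
    V.mulVec (toPhase q p) =
      toPhase (Matrix.toEuclideanLin (V.map Complex.re) q -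
          Matrix.toEuclideanLin (V.map Complex.im) p)
        (Matrix.toEuclideanLin (V.map Complex.im) q +
          Matrix.toEuclideanLin (V.map Complex.re) p) := by
  ext k
  simp only [toPhase, Matrix.mulVec, dotProduct, PiLp.sub_apply, PiLp.add_apply,
    Matrix.toLpLin_apply, Matrix.map_apply]
  push_cast
  rw [← Finset.sum_sub_distrib, ← Finset.sum_add_distrib, Finset.mul_sum,
    ← Finset.sum_add_distrib, Finset.sum_div]
  refine Finset.sum_congr rfl fun j _ => ?_
  conv_lhs => rw [← Complex.re_add_im (V k j)]
  linear_combination ((V k j).im * p j / (√2 : ℝ)) * Complex.I_mul_I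

lemma isSymmetric_toEuclideanLin {M : Matrix (Fin n) (Fin n) ℝ} (hM : M.IsSymm) :
    (Matrix.toEuclideanLin M).IsSymmetric := by
  rw [Matrix.isSymmetric_toEuclideanLin_iff, Matrix.IsHermitian,
    Matrix.conjTranspose_eq_transpose_of_trivial]
  exact hM

/-- Three shears make a phase space rotation: with `T = B (1 + A)⁻¹`, the transformation
`(q, p) ↦ (A q - B p, B q + A p)` is the product of the position shear by `T`, the momentum shear
by `B`, and the position shear by `T`. -/
lemma exists_intertwines_of_shears {A B C : Module.End ℝ (Pos n)} (hA : A.IsSymmetric)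
    (hB : B.IsSymmetric) (hAB : A * B = B * A) (h1 : A * A + B * B = 1) (hC : C * (1 + A) = 1)
    (hC' : (1 + A) * C = 1) :
    ∃ 𝒱 : Mode n ≃ₗᵢ[ℂ] Mode n, ∀ q p f,
      𝒱 (displacement (toPhase q p) f) =
        displacement (toPhase (A q - B p) (B q + A p)) (𝒱 f) := by
  have hBC : B * C = C * B := by
    calc B * C = (C * (1 + A)) * (B * C) := by rw [hC, one_mul]
      _ = C * B * ((1 + A) * C) := by
        rw [mul_assoc C, ← mul_assoc (1 + A), add_mul, one_mul, hAB]; noncomm_ring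
      _ = C * B := by rw [hC', mul_one]
  have hTB : B * C * B = 1 - A := by
    have h2 : B * B = (1 - A) * (1 + A) := by
      rw [← add_left_cancel_iff (a := A * A), h1]; noncomm_ring
    rw [hBC, mul_assoc, h2, ← mul_assoc]
    have h3 : (1 - A) * (1 + A) = (1 + A) * (1 - A) := by noncomm_ring
    rw [mul_assoc, h3, ← mul_assoc, hC, one_mul]
  have hBT : B * (B * C) = 1 - A := by rw [hBC, ← mul_assoc, hTB]
  have hTA : B * C * (1 + A) = B := by rw [mul_assoc, hC, mul_one]
  have hCsymm : C.IsSymmetric := by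
    intro x y
    have e1 : ∀ z, (1 + A) (C z) = z := fun z => congrArg (fun L : Module.End ℝ (Pos n) => L z) hC'
    have e2 : (1 + A).IsSymmetric := LinearMap.IsSymmetric.one.add hA
    calc ⟪C x, y⟫_ℝ = ⟪C x, (1 + A) (C y)⟫_ℝ := by rw [e1]
      _ = ⟪(1 + A) (C x), C y⟫_ℝ := (e2 _ _).symm
      _ = ⟪x, C y⟫_ℝ := by rw [e1]
  have hT : (B * C).IsSymmetric := by
    intro x y
    calc ⟪B (C x), y⟫_ℝ = ⟪x, C (B y)⟫_ℝ := by rw [hB, hCsymm]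
      _ = ⟪x, (B * C) y⟫_ℝ := by rw [hBC]; rfl
  obtain ⟨𝒮, h𝒮⟩ := exists_intertwines_position_shear (B * C) hT
  obtain ⟨𝒢, h𝒢⟩ := exists_intertwines_momentum_shear B hB
  refine ⟨(𝒮.trans 𝒢).trans 𝒮, fun q p f => ?_⟩
  simp only [LinearIsometryEquiv.trans_apply, h𝒮, h𝒢]
  have a1 : ∀ z, B (B (C z)) = z - A z := fun z =>
    congrArg (fun L : Module.End ℝ (Pos n) => L z) hBT
  have a2 : ∀ z, B (C (B z)) = z - A z := fun z =>
    congrArg (fun L : Module.End ℝ (Pos n) => L z) hTB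
  have a3 : ∀ z, B (C z) + B (C (A z)) = B z := fun z => by
    rw [mul_add, mul_one] at hTA
    exact congrArg (fun L : Module.End ℝ (Pos n) => L z) hTA
  have e1 : p + B (q - (B * C) p) = B q + A p := by
    rw [map_sub, Module.End.mul_apply, a1]
    abel
  have e2 : q - (B * C) p - (B * C) (p + B (q - (B * C) p)) = A q - B p := by
    rw [e1, ← a3 p]
    simp only [Module.End.mul_apply, map_add, a2]
    abel
  rw [e2, e1]

/-- A symmetric unitary matrix `V` without the eigenvalue `-1` has a circuit: its real and imaginary
parts are commuting symmetric matrices with `A² + B² = 1`, and `1 + A` is invertible. -/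
lemma exists_intertwines_of_no_neg_one {V : Matrix (Fin n) (Fin n) ℂ}
    (hV : V ∈ Matrix.unitaryGroup (Fin n) ℂ) (hs : V.IsSymm)
    (hne : ∀ v, V.mulVec v = -v → v = 0) :
    ∃ 𝒱 : Mode n ≃ₗᵢ[ℂ] Mode n, Intertwines 𝒱 V.mulVec := by
  set A : Module.End ℝ (Pos n) := Matrix.toEuclideanLin (V.map Complex.re) with hAdef
  set B : Module.End ℝ (Pos n) := Matrix.toEuclideanLin (V.map Complex.im) with hBdef
  have hentry : ∀ j k, ∑ l, V j l * star (V k l) = (1 : Matrix (Fin n) (Fin n) ℂ) j k := by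
    intro j k
    have h := congrFun (congrFun (Matrix.mem_unitaryGroup_iff.1 hV) j) k
    rwa [Matrix.mul_apply] at h
  have hsym : ∀ j k, V j k = V k j := fun j k => hs.apply k j
  have m1 : V.map Complex.re * V.map Complex.re + V.map Complex.im * V.map Complex.im = 1 := by
    ext j k
    have h := congrArg Complex.re (hentry j k)
    rw [Complex.re_sum] at h
    rw [Matrix.add_apply, Matrix.mul_apply, Matrix.mul_apply, ← Finset.sum_add_distrib]
    have h2 : (1 : Matrix (Fin n) (Fin n) ℝ) j k = ((1 : Matrix (Fin n) (Fin n) ℂ) j k).re := by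
      rw [Matrix.one_apply, Matrix.one_apply]
      split_ifs <;> simp
    rw [h2, ← h]
    refine Finset.sum_congr rfl fun l _ => ?_
    rw [hsym k l]
    simp [Complex.mul_re]
  have m2 : V.map Complex.re * V.map Complex.im = V.map Complex.im * V.map Complex.re := by
    ext j k
    have h := congrArg Complex.im (hentry j k)
    rw [Complex.im_sum] at h
    rw [Matrix.mul_apply, Matrix.mul_apply, ← sub_eq_zero, ← Finset.sum_sub_distrib]
    have h2 : ((1 : Matrix (Fin n) (Fin n) ℂ) j k).im = 0 := by
      rw [Matrix.one_apply]
      split_ifs <;> simp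
    rw [h2] at h
    rw [← neg_eq_zero, ← h, ← Finset.sum_neg_distrib]
    refine Finset.sum_congr rfl fun l _ => ?_
    rw [hsym k l]
    simp only [Matrix.map_apply, Complex.mul_im, Complex.star_def, Complex.conj_re, Complex.conj_im]
    ring
  have hAA : A * A + B * B = 1 := by
    change Matrix.toEuclideanLin _ ∘ₗ Matrix.toEuclideanLin _ +
      Matrix.toEuclideanLin _ ∘ₗ Matrix.toEuclideanLin _ = 1
    rw [← Matrix.toLpLin_mul_same, ← Matrix.toLpLin_mul_same, ← map_add, m1, Matrix.toLpLin_one]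
    rfl
  have hAB : A * B = B * A := by
    change Matrix.toEuclideanLin _ ∘ₗ Matrix.toEuclideanLin _ =
      Matrix.toEuclideanLin _ ∘ₗ Matrix.toEuclideanLin _
    rw [← Matrix.toLpLin_mul_same, ← Matrix.toLpLin_mul_same, m2]
  have hA : A.IsSymmetric := isSymmetric_toEuclideanLin (hs.map _)
  have hB : B.IsSymmetric := isSymmetric_toEuclideanLin (hs.map _)
  have hinj : Function.Injective ((1 + A : Module.End ℝ (Pos n)) : Pos n → Pos n) := by
    rw [injective_iff_map_eq_zero]
    intro v hv
    have hAv : A v = -v := by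
      rw [eq_neg_iff_add_eq_zero, add_comm]
      exact hv
    have hBv : B v = 0 := by
      have h2 : A (A v) + B (B v) = v := congrArg (fun L : Module.End ℝ (Pos n) => L v) hAA
      rw [hAv, map_neg, hAv, neg_neg, add_eq_left] at h2
      rw [← norm_eq_zero, ← sq_eq_zero_iff, ← real_inner_self_eq_norm_sq, hB, h2, inner_zero_right]
    have h3 : toPhase v 0 = 0 := by
      apply hne
      rw [mulVec_toPhase, ← hAdef, ← hBdef, hAv, hBv]
      ext k
      simp [toPhase]
      ring
    rw [← posShift_toPhase v 0, h3]
    ext k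
    simp [posShift]
  obtain ⟨C, hC, hC'⟩ : ∃ C : Module.End ℝ (Pos n), C * (1 + A) = 1 ∧ (1 + A) * C = 1 := by
    have hu : IsUnit (1 + A) := (LinearMap.isUnit_iff_ker_eq_bot _).2 (LinearMap.ker_eq_bot.2 hinj)
    obtain ⟨u, hu⟩ := hu
    exact ⟨↑u⁻¹, by rw [← hu]; simp, by rw [← hu]; simp⟩
  obtain ⟨𝒱, h𝒱⟩ := exists_intertwines_of_shears hA hB hAB hAA hC hC'
  refine ⟨𝒱, fun α f => ?_⟩
  rw [← toPhase_posShift_momShift α, h𝒱, mulVec_toPhase]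

/-- Every symmetric unitary matrix has a circuit. -/
lemma exists_intertwines {U : Matrix (Fin n) (Fin n) ℂ}
    (hU : U ∈ Matrix.unitaryGroup (Fin n) ℂ) (hs : U.IsSymm) :
    ∃ 𝒱 : Mode n ≃ₗᵢ[ℂ] Mode n, Intertwines 𝒱 U.mulVec := by
  -- `U = d · d · (d⁻² U)` with a phase `d ≠ -1` such that `-1` is not an eigenvalue of
  -- `d⁻² U`; as `U` has finitely many eigenvalues, all but finitely many phases will do
  obtain ⟨d, hd1, hdre, hd⟩ : ∃ d : ℂ, d * star d = 1 ∧ d ≠ -1 ∧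
      ∀ v, U.mulVec v = -(d * d) • v → v = 0 := by
    have hfin := Module.End.finite_hasEigenvalue (Matrix.toLin' U)
    let g : ℝ → ℂ := fun t => -(Complex.exp (t * Complex.I) * Complex.exp (t * Complex.I))
    have hre : ∀ t, (g t).re = -Real.cos (2 * t) := fun t => by
      simp only [g]
      rw [← Complex.exp_add, Complex.neg_re, ← add_mul, ← two_mul, ← Complex.ofReal_ofNat,
        ← Complex.ofReal_mul, Complex.exp_ofReal_mul_I_re]
    have hg : Set.InjOn g (Set.Ioo 0 1) := by
      intro s hs t ht hst
      have h := congrArg Complex.re hst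
      rw [hre, hre, neg_inj] at h
      have h2 := Real.injOn_cos ⟨by linarith [hs.1], by linarith [hs.2, Real.pi_gt_three]⟩
        ⟨by linarith [ht.1], by linarith [ht.2, Real.pi_gt_three]⟩ h
      linarith
    obtain ⟨z, ⟨t, ht, rfl⟩, hz⟩ :=
      ((Set.Ioo_infinite (zero_lt_one' ℝ)).image hg).exists_notMem_finite hfin
    refine ⟨Complex.exp (t * Complex.I), ?_, fun h => ?_, fun v hv => ?_⟩
    · rw [Complex.star_def, Complex.mul_conj, Complex.normSq_eq_norm_sq,
        Complex.norm_exp_ofReal_mul_I]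
      simp
    · have h2 := congrArg Complex.im h
      rw [Complex.exp_ofReal_mul_I_im] at h2
      have h3 := Real.sin_pos_of_pos_of_lt_pi ht.1 (by linarith [ht.2, Real.pi_gt_three])
      simp at h2
      linarith
    · by_contra hv0
      exact hz (Module.End.hasEigenvalue_of_hasEigenvector
        ⟨Module.End.mem_eigenspace_iff.2 hv, hv0⟩)
  have hd0 : d ≠ 0 := left_ne_zero_of_mul_eq_one hd1
  obtain ⟨𝒲, h𝒲⟩ : ∃ 𝒱 : Mode n ≃ₗᵢ[ℂ] Mode n,
      Intertwines 𝒱 (d • (1 : Matrix (Fin n) (Fin n) ℂ)).mulVec := by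
    refine exists_intertwines_of_no_neg_one ?_ ?_ ?_
    · rw [Matrix.mem_unitaryGroup_iff, star_smul, star_one, smul_mul_smul_comm, hd1]
      simp
    · exact Matrix.isSymm_one.smul d
    · intro v hv
      rw [Matrix.smul_mulVec, Matrix.one_mulVec, ← add_eq_zero_iff_eq_neg] at hv
      have : (d + 1) • v = 0 := by rw [add_smul, one_smul, hv]
      exact (smul_eq_zero.1 this).resolve_left fun h => hdre (eq_neg_of_add_eq_zero_left h)
  obtain ⟨𝒱, h𝒱⟩ : ∃ 𝒱 : Mode n ≃ₗᵢ[ℂ] Mode n, Intertwines 𝒱 ((star d * star d) • U).mulVec := by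
    have hd2 : (star d * star d) * (d * d) = 1 := by linear_combination (d * star d + 1) * hd1
    refine exists_intertwines_of_no_neg_one ?_ (hs.smul _) ?_
    · rw [Matrix.mem_unitaryGroup_iff, star_smul, smul_mul_smul_comm,
        Matrix.mem_unitaryGroup_iff.1 hU]
      simp only [star_mul', star_star]
      rw [hd2, one_smul]
    · intro v hv
      apply hd
      rw [Matrix.smul_mulVec] at hv
      have h2 := congrArg (fun w => (d * d) • w) hv
      simp only [smul_smul] at h2
      rw [mul_comm, hd2, one_smul, smul_neg, ← neg_smul] at h2
      exact h2
  refine ⟨(𝒱.trans 𝒲).trans 𝒲, ?_⟩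
  have h := (h𝒱.trans h𝒲).trans h𝒲
  convert h using 1
  ext1 v
  simp only [Function.comp_apply, Matrix.smul_mulVec, Matrix.one_mulVec, smul_smul]
  have hd2 : d * (d * (star d * star d)) = 1 := by linear_combination (d * star d + 1) * hd1
  rw [hd2, one_smul]

lemma exists_isLinearOptical {U : Matrix (Fin n) (Fin n) ℂ}
    (hU : U ∈ Matrix.unitaryGroup (Fin n) ℂ) (hs : U.IsSymm) :
    ∃ 𝒰 : Mode n ≃ₗᵢ[ℂ] Mode n, IsLinearOptical U 𝒰 := by
  obtain ⟨𝒱, h𝒱⟩ := exists_intertwines hU hs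
  refine ⟨𝒱.symm, fun α f => ?_⟩
  rw [LinearIsometryEquiv.symm_symm, h𝒱, LinearIsometryEquiv.apply_symm_apply, hs.eq]

end SymmetricUnitary

/-! ### Measurements defined by isometries into `L²` -/

section Naimark

variable {H : Type*} [NormedAddCommGroup H] [InnerProductSpace ℂ H] [CompleteSpace H]
  {Ω : Type*} [MeasurableSpace Ω] {ν : Measure Ω}

/-- The map `ψ ↦ (V ψ)|_B`. -/
def restrictAmplitude (V : H →ₗᵢ[ℂ] Lp ℂ 2 ν) (B : Set Ω) : H →L[ℂ] Lp ℂ 2 (ν.restrict B) :=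
  LpToLpRestrictCLM Ω ℂ ℂ ν 2 B ∘L V.toContinuousLinearMap

/-- The compression `V† 1_B V` of the multiplication operator with the indicator of `B`. -/
def isometryEffect (V : H →ₗᵢ[ℂ] Lp ℂ 2 ν) (B : Set Ω) : H →L[ℂ] H :=
  (restrictAmplitude V B).adjoint ∘L restrictAmplitude V B

lemma inner_isometryEffect (V : H →ₗᵢ[ℂ] Lp ℂ 2 ν) (B : Set Ω) (x y : H) :
    ⟪x, isometryEffect V B y⟫_ℂ = ∫ ω in B, ⟪V x ω, V y ω⟫_ℂ ∂ν := by
  rw [isometryEffect, ContinuousLinearMap.comp_apply, ContinuousLinearMap.adjoint_inner_right,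
    L2.inner_def]
  refine integral_congr_ae ?_
  filter_upwards [LpToLpRestrictCLM_coeFn ℂ B (V x), LpToLpRestrictCLM_coeFn ℂ B (V y)]
    with ω h1 h2
  exact congrArg₂ (fun a b => ⟪a, b⟫_ℂ) h1 h2

lemma norm_isometryEffect_sq_le (V : H →ₗᵢ[ℂ] Lp ℂ 2 ν) (B : Set Ω) (x : H) :
    ‖isometryEffect V B x‖ ^ 2 ≤ ∫ ω in B, ‖V x ω‖ ^ 2 ∂ν := by
  have h0 : ‖restrictAmplitude V B‖ ≤ 1 := by
    refine ContinuousLinearMap.opNorm_le_bound _ zero_le_one fun y => ?_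
    rw [one_mul, ← V.norm_map y]
    exact norm_Lp_toLp_restrict_le B (V y)
  have h1 : ‖isometryEffect V B x‖ ≤ ‖restrictAmplitude V B x‖ := by
    refine ((restrictAmplitude V B).adjoint.le_opNorm _).trans ?_
    rw [LinearIsometryEquiv.norm_map]
    exact mul_le_of_le_one_left (norm_nonneg _) h0
  have h2 : ((‖restrictAmplitude V B x‖ ^ 2 : ℝ) : ℂ) =
      ((∫ ω in B, ‖V x ω‖ ^ 2 ∂ν : ℝ) : ℂ) := by
    rw [← inner_self_eq_ofReal_norm_sq, ← ContinuousLinearMap.adjoint_inner_right]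
    refine (inner_isometryEffect V B x x).trans ?_
    rw [← integral_complex_ofReal]
    simp only [inner_self_eq_ofReal_norm_sq]
  rw [← Complex.ofReal_inj.1 h2]
  exact pow_le_pow_left₀ (norm_nonneg _) h1 2

lemma hasSum_isometryEffect (V : H →ₗᵢ[ℂ] Lp ℂ 2 ν) {B : ℕ → Set Ω}
    (hB : ∀ k, MeasurableSet (B k)) (hd : Pairwise fun j k => Disjoint (B j) (B k)) (ψ : H) :
    HasSum (fun k => isometryEffect V (B k) ψ) (isometryEffect V (⋃ k, B k) ψ) := by
  have hint : ∀ x, Integrable (fun ω => ⟪V x ω, V ψ ω⟫_ℂ) ν := fun x => L2.integrable_inner _ _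
  have hint2 : Integrable (fun ω => ‖V ψ ω‖ ^ 2) ν :=
    (Lp.memLp (V ψ)).integrable_norm_pow two_ne_zero
  let r : Finset ℕ → Set Ω := fun s => (⋃ k, B k) \ ⋃ k ∈ s, B k
  have hm : ∀ s : Finset ℕ, MeasurableSet (⋃ k ∈ s, B k) := fun s =>
    s.measurableSet_biUnion fun k _ => hB k
  have hsub : ∀ s : Finset ℕ, ⋃ k ∈ s, B k ⊆ ⋃ k, B k := fun s =>
    Set.iUnion₂_subset fun k _ => Set.subset_iUnion B k
  -- what is missing from a partial sum is the effect of the remaining event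
  have key : ∀ s : Finset ℕ, ∑ k ∈ s, isometryEffect V (B k) ψ - isometryEffect V (⋃ k, B k) ψ =
      -isometryEffect V (r s) ψ := by
    intro s
    refine ext_inner_left ℂ fun x => ?_
    rw [inner_sub_right, inner_sum, inner_neg_right]
    simp only [inner_isometryEffect]
    rw [← integral_biUnion_finset s (fun k _ => hB k) (fun j _ k _ hjk => hd hjk)
      (fun k _ => (hint x).integrableOn), setIntegral_sdiff (hm s) (hint x).integrableOn (hsub s)]
    ring
  have hr : ∀ s : Finset ℕ, ∫ ω in r s, ‖V ψ ω‖ ^ 2 ∂ν =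
      ∫ ω in ⋃ k, B k, ‖V ψ ω‖ ^ 2 ∂ν - ∑ k ∈ s, ∫ ω in B k, ‖V ψ ω‖ ^ 2 ∂ν := by
    intro s
    rw [setIntegral_sdiff (hm s) hint2.integrableOn (hsub s), ← integral_biUnion_finset s
      (fun k _ => hB k) (fun j _ k _ hjk => hd hjk) (fun k _ => hint2.integrableOn)]
  have hlim := hasSum_integral_iUnion hB hd hint2.integrableOn
  rw [HasSum, tendsto_iff_norm_sub_tendsto_zero]
  have h0 : Filter.Tendsto (fun s => √(∫ ω in r s, ‖V ψ ω‖ ^ 2 ∂ν)) Filter.atTop (nhds 0) := by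
    rw [← Real.sqrt_zero]
    refine (Real.continuous_sqrt.tendsto 0).comp ?_
    simp only [hr]
    rw [← sub_self (∫ ω in ⋃ k, B k, ‖V ψ ω‖ ^ 2 ∂ν)]
    have h1 := hlim.const_sub (∫ ω in ⋃ k, B k, ‖V ψ ω‖ ^ 2 ∂ν)
    simpa using h1
  simp only [SummationFilter.unconditional_filter]
  refine squeeze_zero (fun s => norm_nonneg _) (fun s => ?_) h0
  rw [key, norm_neg]
  exact Real.le_sqrt_of_sq_le (norm_isometryEffect_sq_le V _ ψ)

/-- An isometry `V` into `L²(ν)` defines the measurement with the effects `V† 1_B V`. -/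
def POVM.ofIsometry (V : H →ₗᵢ[ℂ] Lp ℂ 2 ν) : POVM Ω H where
  effect := isometryEffect V
  effect_isPositive B _ := ContinuousLinearMap.isPositive_adjoint_comp_self _
  effect_univ := by
    ext y
    refine ext_inner_left ℂ fun x => ?_
    rw [inner_isometryEffect, Measure.restrict_univ, ← L2.inner_def, V.inner_map_map]
    rfl
  effect_iUnion _ hB hd ψ := hasSum_isometryEffect V hB hd ψ

end Naimark

/-! ### Isometric bilinear maps and the Hilbert space tensor product -/

section Bilinear

variable {H K L : Type*} [NormedAddCommGroup H] [InnerProductSpace ℂ H]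
  [NormedAddCommGroup K] [InnerProductSpace ℂ K] [NormedAddCommGroup L] [InnerProductSpace ℂ L]

/-- By polarization in each variable, a bilinear map that multiplies norms multiplies inner
products. -/
lemma inner_bilin_of_norm [CompleteSpace H] [CompleteSpace K] [CompleteSpace L]
    (B : H →L[ℂ] K →L[ℂ] L) (hB : ∀ f g, ‖B f g‖ = ‖f‖ * ‖g‖)
    (f f' : H) (g g' : K) : ⟪B f g, B f' g'⟫_ℂ = ⟪f, f'⟫_ℂ * ⟪g, g'⟫_ℂ := by
  have h1 : ∀ (g : K) (f f' : H), ⟪B f g, B f' g⟫_ℂ = ⟪f, f'⟫_ℂ * ⟪g, g⟫_ℂ := by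
    intro g f f'
    have h := (ext_inner_map (((B.flip g).adjoint ∘L B.flip g : H →L[ℂ] H) : H →ₗ[ℂ] H)
      ((⟪g, g⟫_ℂ • (1 : H →L[ℂ] H) : H →L[ℂ] H) : H →ₗ[ℂ] H)).1 fun x => by
        simp only [ContinuousLinearMap.coe_coe, ContinuousLinearMap.comp_apply,
          ContinuousLinearMap.adjoint_inner_left, ContinuousLinearMap.flip_apply,
          _root_.smul_apply, one_apply_eq_self, inner_smul_left,
          inner_self_eq_ofReal_norm_sq, hB, Complex.conj_ofReal]
        push_cast
        ring
    have h2 := congrArg (fun T : H →ₗ[ℂ] H => ⟪f, T f'⟫_ℂ) h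
    simp only [ContinuousLinearMap.coe_coe, ContinuousLinearMap.comp_apply,
      ContinuousLinearMap.adjoint_inner_right, ContinuousLinearMap.flip_apply,
      _root_.smul_apply, one_apply_eq_self, inner_smul_right] at h2
    rw [h2, mul_comm]
  have h := (ext_inner_map (((B f).adjoint ∘L B f' : K →L[ℂ] K) : K →ₗ[ℂ] K)
    ((⟪f, f'⟫_ℂ • (1 : K →L[ℂ] K) : K →L[ℂ] K) : K →ₗ[ℂ] K)).1 fun x => by
      simp only [ContinuousLinearMap.coe_coe, ContinuousLinearMap.comp_apply,
        ContinuousLinearMap.adjoint_inner_left, h1,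
        _root_.smul_apply, one_apply_eq_self, inner_smul_left,
        inner_conj_symm]
  have h2 := congrArg (fun T : K →ₗ[ℂ] K => ⟪g, T g'⟫_ℂ) h
  simpa only [ContinuousLinearMap.coe_coe, ContinuousLinearMap.comp_apply,
      ContinuousLinearMap.adjoint_inner_right,
      _root_.smul_apply, one_apply_eq_self, inner_smul_right] using h2

/-- A bilinear map that multiplies inner products extends to an isometry on the Hilbert space tensor
product. -/
lemma exists_isometry_tensor [CompleteSpace L] (B : H →L[ℂ] K →L[ℂ] L)
    (hB : ∀ f g f' g', ⟪B f g, B f' g'⟫_ℂ = ⟪f, f'⟫_ℂ * ⟪g, g'⟫_ℂ) :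
    ∃ V : HTensor H K →ₗᵢ[ℂ] L, ∀ f g, V (tensorVec f g) = B f g := by
  let B₀ : H →ₗ[ℂ] K →ₗ[ℂ] L := LinearMap.mk₂ ℂ (fun f g => B f g) (by simp) (by simp) (by simp)
    (by simp)
  let V₀ : H ⊗[ℂ] K →ₗ[ℂ] L := TensorProduct.lift B₀
  have hV₀ : ∀ f g, V₀ (f ⊗ₜ g) = B f g := fun f g => TensorProduct.lift.tmul _ _
  have h1 : ∀ s t, ⟪V₀ s, V₀ t⟫_ℂ = ⟪s, t⟫_ℂ := by
    intro s t
    induction s with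
    | zero => simp
    | add a b ha hb => rw [map_add, inner_add_left, inner_add_left, ha, hb]
    | tmul f g =>
      induction t with
      | zero => simp
      | add a b ha hb => rw [map_add, inner_add_right, inner_add_right, ha, hb]
      | tmul f' g' => rw [hV₀, hV₀, hB, TensorProduct.inner_tmul]
  have h2 : ∀ t, ‖V₀ t‖ = ‖t‖ := fun t => by
    rw [← Real.sqrt_sq (norm_nonneg (V₀ t)), ← Real.sqrt_sq (norm_nonneg t)]
    congr 1
    exact Complex.ofReal_injective (by
      rw [← inner_self_eq_ofReal_norm_sq, ← inner_self_eq_ofReal_norm_sq, h1])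
  let V₁ : H ⊗[ℂ] K →L[ℂ] L := (⟨V₀, h2⟩ : H ⊗[ℂ] K →ₗᵢ[ℂ] L).toContinuousLinearMap
  have hd : DenseRange (Completion.toComplL (𝕜 := ℂ) (E := H ⊗[ℂ] K)) :=
    Completion.denseRange_coe
  have hu : IsUniformInducing (Completion.toComplL (𝕜 := ℂ) (E := H ⊗[ℂ] K)) :=
    Completion.isUniformInducing_coe _
  let V := V₁.extend Completion.toComplL
  have hV : ∀ t : H ⊗[ℂ] K, V (t : Completion (H ⊗[ℂ] K)) = V₀ t := fun t =>
    ContinuousLinearMap.extend_eq V₁ hd hu t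
  refine ⟨⟨(V : HTensor H K →ₗ[ℂ] L), fun t => ?_⟩, fun f g => (hV _).trans (hV₀ f g)⟩
  refine Completion.induction_on t (isClosed_eq (V.continuous.norm) continuous_norm) fun t => ?_
  rw [ContinuousLinearMap.coe_coe, hV, h2, Completion.norm_coe]

end Bilinear

/-! ### The Bell measurement -/

section Bell

open FourierTransform

variable {n : ℕ}

lemma bellAmplitude_eq_inner (f g : Mode n) (ζ : Phase n) :
    bellAmplitude f g ζ = ⟪star f, displacement (-ζ) g⟫_ℂ := by
  rw [L2.inner_def, bellAmplitude]
  refine integral_congr_ae ?_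
  filter_upwards [Lp.coeFn_star f] with x hx
  simp [hx, mul_comm]

/-- The displacement `D(α) ⊗ D(α*)` is diagonal in the Bell measurement. -/
lemma bellAmplitude_displacement (α : Phase n) (f g : Mode n) (ζ : Phase n) :
    bellAmplitude (displacement α f) (displacement (star α) g) ζ =
      Complex.exp (-(ζ ⬝ᵥ α - star ζ ⬝ᵥ star α)) * bellAmplitude f g ζ := by
  rw [bellAmplitude_eq_inner, bellAmplitude_eq_inner, star_displacement, displacement_comm,
    inner_smul_right, inner_displacement_displacement]
  congr 2
  rw [star_star, star_neg, neg_dotProduct, neg_dotProduct]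
  ring

/-- The product `u ↦ f(u) g(u + q)`, whose Fourier transform is the Bell amplitude. -/
def shiftProd (f g : Pos n → ℂ) (q u : Pos n) : ℂ := f u * g (u + q)

lemma enorm_bellAmplitude (f g : Mode n) (ζ : Phase n) :
    ‖bellAmplitude f g ζ‖ₑ =
      ‖𝓕 (shiftProd f g (posShift ζ)) ((2 * Real.pi)⁻¹ • momShift ζ)‖ₑ := by
  have h : bellAmplitude f g ζ =
      Complex.exp (((-(⟪momShift ζ, posShift ζ⟫_ℝ / 2) : ℝ) : ℂ) * Complex.I) *
        𝓕 (shiftProd f g (posShift ζ)) ((2 * Real.pi)⁻¹ • momShift ζ) := by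
    rw [bellAmplitude, Real.fourier_eq', ← integral_const_mul]
    refine integral_congr_ae ?_
    filter_upwards [displacement_ae (-ζ) g] with x hx
    rw [hx]
    simp only [displacedFun, shiftProd, posShift_neg, momShift_neg, sub_neg_eq_add, smul_eq_mul,
      inner_neg_left, inner_neg_right, neg_neg, inner_smul_left, real_inner_comm _ x]
    simp only [conj_trivial]
    rw [← mul_assoc (Complex.exp _) (Complex.exp _), ← Complex.exp_add]
    rw [mul_left_comm]
    congr 2
    have hpi : (Real.pi : ℂ) ≠ 0 := by exact_mod_cast Real.pi_ne_zero
    push_cast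
    field_simp
    ring
  rw [h, enorm_mul, ← ofReal_norm, Complex.norm_exp_ofReal_mul_I]
  simp

/-- The real and imaginary parts of the coordinates of phase space. -/
def reIm (ζ : Phase n) : Pos n × Pos n :=
  (WithLp.toLp 2 fun k => (ζ k).re, WithLp.toLp 2 fun k => (ζ k).im)

lemma measurePreserving_reIm : MeasurePreserving (reIm : Phase n → Pos n × Pos n) := by
  have h1 : MeasurePreserving (fun (ζ : Phase n) k => Complex.measurableEquivRealProd (ζ k)) :=
    volume_preserving_pi fun _ => Complex.volume_preserving_equiv_real_prod
  have h2 := volume_measurePreserving_arrowProdEquivProdArrow ℝ ℝ (Fin n)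
  have h3 := (PiLp.volume_preserving_toLp (Fin n)).prod (PiLp.volume_preserving_toLp (Fin n))
  exact (h3.comp h2).comp h1

lemma posShift_eq_smul (ζ : Phase n) : posShift ζ = √2 • (reIm ζ).1 := by
  ext k
  simp [posShift, reIm]

lemma momShift_eq_smul (ζ : Phase n) : momShift ζ = √2 • (reIm ζ).2 := by
  ext k
  simp [momShift, reIm]

lemma lintegral_comp_smul {F : Pos n → ENNReal} (hF : Measurable F) {c : ℝ} (hc : 0 < c) :
    ∫⁻ x, F (c • x) = ENNReal.ofReal (c⁻¹ ^ n) * ∫⁻ x, F x := by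
  have h := lintegral_map (μ := (volume : Measure (Pos n))) hF (measurable_const_smul c)
  rw [Measure.map_addHaar_smul _ hc.ne', lintegral_smul_measure] at h
  rw [← h, smul_eq_mul, finrank_euclideanSpace, Fintype.card_fin, abs_of_pos (by positivity),
    inv_pow]

lemma integrable_shiftProd (f g : Mode n) (q : Pos n) : Integrable (shiftProd f g q) :=
  (Lp.memLp f).integrable_mul
    ((Lp.memLp g).comp_measurePreserving (measurePreserving_add_right volume q))

lemma measurable_shiftProd (f g : Mode n) :
    Measurable fun z : Pos n × Pos n => shiftProd f g z.1 z.2 := by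
  have hf := (Lp.stronglyMeasurable f).measurable
  have hg := (Lp.stronglyMeasurable g).measurable
  exact (hf.comp measurable_snd).mul (hg.comp (measurable_snd.add measurable_fst))

lemma measurable_fourier_shiftProd (f g : Mode n) :
    Measurable fun z : Pos n × Pos n => 𝓕 (shiftProd f g z.1) z.2 := by
  simp only [Real.fourier_eq']
  refine (StronglyMeasurable.integral_prod_right (ν := volume)
    (f := fun (z : Pos n × Pos n) (u : Pos n) =>
      Complex.exp (((-2 * Real.pi * ⟪u, z.2⟫_ℝ : ℝ) : ℂ) * Complex.I) • shiftProd f g z.1 u)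
    ?_).measurable
  refine Measurable.stronglyMeasurable ?_
  have hc : Continuous fun z : (Pos n × Pos n) × Pos n =>
      Complex.exp (((-2 * Real.pi * ⟪z.2, z.1.2⟫_ℝ : ℝ) : ℂ) * Complex.I) := by fun_prop
  exact hc.measurable.smul ((measurable_shiftProd f g).comp
    (measurable_fst.fst.prodMk measurable_snd))

lemma lintegral_shiftProd_sq (f g : Mode n) :
    ∫⁻ q, ∫⁻ u, ‖shiftProd f g (√2 • q) u‖ₑ ^ 2 =
      ENNReal.ofReal ((√2)⁻¹ ^ n) * ((∫⁻ x, ‖f x‖ₑ ^ 2) * ∫⁻ x, ‖g x‖ₑ ^ 2) := by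
  have hf := (Lp.stronglyMeasurable f).measurable
  have hg := (Lp.stronglyMeasurable g).measurable
  rw [lintegral_lintegral_swap]
  · have h : ∀ u, ∫⁻ q, ‖shiftProd f g (√2 • q) u‖ₑ ^ 2 =
        ‖f u‖ₑ ^ 2 * (ENNReal.ofReal ((√2)⁻¹ ^ n) * ∫⁻ x, ‖g x‖ₑ ^ 2) := by
      intro u
      have h1 : Measurable fun x => ‖g (u + x)‖ₑ ^ 2 :=
        ((hg.comp (measurable_const_add u)).enorm).pow_const 2
      simp only [shiftProd, enorm_mul, mul_pow]
      rw [lintegral_const_mul' _ _ (by simp), lintegral_comp_smul h1 (by positivity),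
        lintegral_add_left_eq_self (fun x => ‖g x‖ₑ ^ 2) u]
    simp only [h]
    rw [lintegral_mul_const _ (hf.enorm.pow_const 2)]
    ring
  · refine Measurable.aemeasurable ?_
    exact ((measurable_shiftProd f g).comp
      ((measurable_fst.const_smul √2).prodMk measurable_snd)).enorm.pow_const 2

lemma lintegral_sq_eq_norm_sq {α : Type*} [MeasurableSpace α] {μ : Measure α} (f : Lp ℂ 2 μ) :
    ∫⁻ x, ‖f x‖ₑ ^ 2 ∂μ = ENNReal.ofReal (‖f‖ ^ 2) := by
  have h := Lp.enorm_def f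
  rw [eLpNorm_eq_lintegral_rpow_enorm_toReal two_ne_zero ENNReal.ofNat_ne_top] at h
  rw [ENNReal.ofReal_pow (norm_nonneg _), ofReal_norm, h, ← ENNReal.rpow_natCast,
    ← ENNReal.rpow_mul]
  simp

lemma ae_memLp_shiftProd (f g : Mode n) :
    ∀ᵐ q : Pos n, MemLp (shiftProd f g (√2 • q)) 2 := by
  have hmeas : Measurable fun z : Pos n × Pos n => ‖shiftProd f g (√2 • z.1) z.2‖ₑ ^ 2 :=
    ((measurable_shiftProd f g).comp
      ((measurable_fst.const_smul √2).prodMk measurable_snd)).enorm.pow_const 2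
  have hfin : ∀ᵐ q : Pos n, ∫⁻ u, ‖shiftProd f g (√2 • q) u‖ₑ ^ 2 < ⊤ := by
    refine ae_lt_top hmeas.lintegral_prod_right' ?_
    rw [lintegral_shiftProd_sq, lintegral_sq_eq_norm_sq, lintegral_sq_eq_norm_sq]
    exact ENNReal.mul_ne_top ENNReal.ofReal_ne_top
      (ENNReal.mul_ne_top ENNReal.ofReal_ne_top ENNReal.ofReal_ne_top)
  filter_upwards [hfin] with q hq
  refine ⟨(integrable_shiftProd f g _).1, ?_⟩
  rw [eLpNorm_lt_top_iff_lintegral_rpow_enorm_lt_top two_ne_zero ENNReal.ofNat_ne_top]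
  simpa only [ENNReal.toReal_ofNat, ENNReal.rpow_ofNat] using hq

lemma lintegral_fourier_shiftProd_sq (f g : Mode n) {c : ℝ} (hc : 0 < c) :
    ∫⁻ q, ∫⁻ p, ‖𝓕 (shiftProd f g (√2 • q)) (c • p)‖ₑ ^ 2 =
      ENNReal.ofReal (c⁻¹ ^ n) * ∫⁻ q, ∫⁻ u, ‖shiftProd f g (√2 • q) u‖ₑ ^ 2 := by
  rw [← lintegral_const_mul' _ _ ENNReal.ofReal_ne_top]
  refine lintegral_congr_ae ?_
  filter_upwards [ae_memLp_shiftProd f g] with q hq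
  have h3 : Measurable fun ξ => ‖𝓕 (shiftProd f g (√2 • q)) ξ‖ₑ ^ 2 :=
    ((measurable_fourier_shiftProd f g).comp
      (measurable_const.prodMk measurable_id)).enorm.pow_const 2
  rw [lintegral_comp_smul h3 hc, lintegral_fourier_sq (integrable_shiftProd f g _) hq]

lemma lintegral_bellAmplitude_sq_eq_prod (f g : Mode n) :
    ∫⁻ ζ, ‖bellAmplitude f g ζ‖ₑ ^ 2 =
      ∫⁻ q, ∫⁻ p, ‖𝓕 (shiftProd f g (√2 • q)) (((2 * Real.pi)⁻¹ * √2) • p)‖ₑ ^ 2 := by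
  let F : Pos n × Pos n → ENNReal := fun z =>
    ‖𝓕 (shiftProd f g (√2 • z.1)) (((2 * Real.pi)⁻¹ * √2) • z.2)‖ₑ ^ 2
  have h0 : Measurable fun z : Pos n × Pos n => (√2 • z.1, ((2 * Real.pi)⁻¹ * √2) • z.2) :=
    (measurable_fst.const_smul √2).prodMk (measurable_snd.const_smul ((2 * Real.pi)⁻¹ * √2))
  have hmeas : Measurable F := ((measurable_fourier_shiftProd f g).comp h0).enorm.pow_const 2
  have h1 : ∀ ζ : Phase n, ‖bellAmplitude f g ζ‖ₑ ^ 2 = F (reIm ζ) := fun ζ => by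
    simp only [F, enorm_bellAmplitude, posShift_eq_smul, momShift_eq_smul, smul_smul]
  rw [lintegral_congr h1, measurePreserving_reIm.lintegral_comp hmeas, Measure.volume_eq_prod,
    lintegral_prod F hmeas.aemeasurable]

/-- The Bell amplitudes satisfy `∫ |⟨Ψ_ζ | f ⊗ g⟩|² d²ⁿζ = πⁿ ‖f‖² ‖g‖²`: apply Plancherel's theorem
in the momentum, then Tonelli's theorem in the position. -/
lemma lintegral_bellAmplitude_sq (f g : Mode n) :
    ∫⁻ ζ, ‖bellAmplitude f g ζ‖ₑ ^ 2 = ENNReal.ofReal (Real.pi ^ n * (‖f‖ ^ 2 * ‖g‖ ^ 2)) := by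
  have hconst : (((2 * Real.pi)⁻¹ * √2)⁻¹ ^ n) * ((√2)⁻¹ ^ n) = Real.pi ^ n := by
    rw [← mul_pow]
    congr 1
    have h4 : √2 * √2 = 2 := Real.mul_self_sqrt (by norm_num)
    have h5 := Real.pi_ne_zero
    field_simp
    linear_combination -h4
  rw [lintegral_bellAmplitude_sq_eq_prod, lintegral_fourier_shiftProd_sq f g (by positivity),
    lintegral_shiftProd_sq, lintegral_sq_eq_norm_sq, lintegral_sq_eq_norm_sq,
    ← ENNReal.ofReal_mul (by positivity), ← ENNReal.ofReal_mul (by positivity),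
    ← ENNReal.ofReal_mul (by positivity), ← mul_assoc, hconst]

lemma aestronglyMeasurable_bellAmplitude (f g : Mode n) :
    AEStronglyMeasurable (bellAmplitude f g) volume := by
  have h : bellAmplitude f g = fun ζ => ∫ x, f x * displacedFun (-ζ) g x := by
    ext ζ
    refine integral_congr_ae ?_
    filter_upwards [displacement_ae (-ζ) g] with x hx
    rw [hx]
  rw [h]
  refine (StronglyMeasurable.integral_prod_right (ν := volume)
    (f := fun (ζ : Phase n) (x : Pos n) => f x * displacedFun (-ζ) g x)
    (Measurable.stronglyMeasurable ?_)).aestronglyMeasurable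
  have hf := (Lp.stronglyMeasurable f).measurable
  have hg := (Lp.stronglyMeasurable g).measurable
  have hp : Continuous (posShift : Phase n → Pos n) := by unfold posShift; fun_prop
  have hm : Continuous (momShift : Phase n → Pos n) := by unfold momShift; fun_prop
  refine (hf.comp measurable_snd).mul (Measurable.mul ?_ (hg.comp ?_))
  · refine Continuous.measurable ?_
    fun_prop
  · refine Continuous.measurable ?_
    fun_prop

lemma memLp_bellAmplitude (f g : Mode n) : MemLp (bellAmplitude f g) 2 volume := by
  refine ⟨aestronglyMeasurable_bellAmplitude f g, ?_⟩
  rw [eLpNorm_lt_top_iff_lintegral_rpow_enorm_lt_top two_ne_zero ENNReal.ofNat_ne_top]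
  have h := lintegral_bellAmplitude_sq f g
  simp only [ENNReal.toReal_ofNat, ENNReal.rpow_ofNat, h, ENNReal.ofReal_lt_top]

/-- The normalisation `π^(-n/2)` of the Bell amplitudes. -/
def bellConst (n : ℕ) : ℝ := (√(Real.pi ^ n))⁻¹

/-- The normalised Bell amplitude `π^(-n/2) ⟨Ψ| (I ⊗ D(ζ)†) |f ⊗ g⟩` as an element of `L²(ℂⁿ)`. -/
def bellLp (f g : Mode n) : Lp ℂ 2 (volume : Measure (Phase n)) :=
  (bellConst n : ℂ) • (memLp_bellAmplitude f g).toLp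

lemma bellLp_ae (f g : Mode n) :
    bellLp f g =ᵐ[volume] fun ζ => (bellConst n : ℂ) * bellAmplitude f g ζ := by
  filter_upwards [Lp.coeFn_smul (bellConst n : ℂ) (memLp_bellAmplitude f g).toLp,
    (memLp_bellAmplitude f g).coeFn_toLp] with ζ h1 h2
  rw [bellLp, h1, Pi.smul_apply, h2, smul_eq_mul]

lemma norm_bellLp (f g : Mode n) : ‖bellLp f g‖ = ‖f‖ * ‖g‖ := by
  have hpi : 0 < Real.pi ^ n := by positivity
  let b : Lp ℂ 2 (volume : Measure (Phase n)) := (memLp_bellAmplitude f g).toLp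
  have h1 := lintegral_sq_eq_norm_sq b
  have h2 : ∫⁻ ζ, ‖b ζ‖ₑ ^ 2 =
      ∫⁻ ζ, ‖bellAmplitude f g ζ‖ₑ ^ 2 := by
    refine lintegral_congr_ae ?_
    filter_upwards [MemLp.coeFn_toLp (memLp_bellAmplitude f g)] with ζ hζ
    rw [hζ]
  rw [h2, lintegral_bellAmplitude_sq, ENNReal.ofReal_eq_ofReal_iff (by positivity)
    (by positivity)] at h1
  change ‖(bellConst n : ℂ) • b‖ = _
  rw [norm_smul, Complex.norm_real, bellConst, Real.norm_of_nonneg (by positivity),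
    inv_mul_eq_iff_eq_mul₀ (by positivity), ← Real.sqrt_sq (norm_nonneg b), ← h1,
    ← mul_pow, Real.sqrt_mul hpi.le, Real.sqrt_sq (by positivity)]

/-- The bilinear map `(f, g) ↦ bellLp f g`. -/
def bellBilin (n : ℕ) : Mode n →L[ℂ] Mode n →L[ℂ] Lp ℂ 2 (volume : Measure (Phase n)) :=
  LinearMap.mkContinuous₂
    (LinearMap.mk₂ ℂ bellLp
      (fun f f' g => by
        rw [bellLp, bellLp, bellLp, ← smul_add, ← MemLp.toLp_add]
        congr 2
        ext ζ
        simp only [Pi.add_apply, bellAmplitude_eq_inner, star_mode_add, inner_add_left])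
      (fun c f g => by
        rw [bellLp, bellLp, smul_comm, ← MemLp.toLp_const_smul]
        congr 2
        ext ζ
        simp [bellAmplitude_eq_inner, star_mode_smul, inner_smul_left])
      (fun f g g' => by
        rw [bellLp, bellLp, bellLp, ← smul_add, ← MemLp.toLp_add]
        congr 2
        ext ζ
        simp only [Pi.add_apply, bellAmplitude_eq_inner, map_add, inner_add_right])
      (fun c f g => by
        rw [bellLp, bellLp, smul_comm, ← MemLp.toLp_const_smul]
        congr 2
        ext ζ
        simp [bellAmplitude_eq_inner, inner_smul_right]))
    1 fun f g => by
      rw [one_mul]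
      exact (norm_bellLp f g).le

lemma exists_bellIsometry (n : ℕ) :
    ∃ V : HTensor (Mode n) (Mode n) →ₗᵢ[ℂ] Lp ℂ 2 (volume : Measure (Phase n)),
      ∀ f g, V (tensorVec f g) = bellLp f g :=
  exists_isometry_tensor (bellBilin n) (fun f g f' g' =>
    inner_bilin_of_norm (bellBilin n) norm_bellLp f f' g g')

/-- The isometry `f ⊗ g ↦ π^(-n/2) ⟨Ψ| (I ⊗ D(·)†) |f ⊗ g⟩`. -/
def bellIsometry (n : ℕ) :
    HTensor (Mode n) (Mode n) →ₗᵢ[ℂ] Lp ℂ 2 (volume : Measure (Phase n)) :=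
  (exists_bellIsometry n).choose

lemma bellIsometry_tensorVec (f g : Mode n) : bellIsometry n (tensorVec f g) = bellLp f g :=
  (exists_bellIsometry n).choose_spec f g

lemma bellConst_sq (n : ℕ) : (bellConst n : ℂ) * bellConst n = ((Real.pi : ℂ) ^ n)⁻¹ := by
  rw [← Complex.ofReal_mul, bellConst, ← mul_inv, Real.mul_self_sqrt (by positivity)]
  simp

lemma isBellMeasurement_ofIsometry :
    IsBellMeasurement (POVM.ofIsometry (bellIsometry n)) := by
  intro B _ f g f' g'
  refine ⟨?_, ?_⟩
  · exact ((memLp_bellAmplitude f g).star.integrable_mul (memLp_bellAmplitude f' g')).integrableOn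
  · refine (inner_isometryEffect (bellIsometry n) B _ _).trans ?_
    rw [bellIsometry_tensorVec, bellIsometry_tensorVec, ← integral_const_mul]
    refine integral_congr_ae (ae_restrict_of_ae ?_)
    filter_upwards [bellLp_ae f g, bellLp_ae f' g'] with ζ h1 h2
    rw [h1, h2, ← bellConst_sq]
    simp
    ring

end Bell

/-! ### Reflected states -/

section Reflection

variable {n : ℕ}

lemma mulVec_star_mulVec_star {U : Matrix (Fin n) (Fin n) ℂ}
    (hU : U ∈ Matrix.unitaryGroup (Fin n) ℂ) (hs : U.IsSymm) (α : Phase n) :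
    U.mulVec (star (U.mulVec (star α))) = α := by
  have h : U.conjTranspose.transpose = star U := by
    rw [Matrix.star_eq_conjTranspose, Matrix.conjTranspose, ← Matrix.transpose_map, hs.eq, hs.eq]
  rw [Matrix.star_mulVec, star_star, ← Matrix.mulVec_transpose, Matrix.mulVec_mulVec, h,
    Matrix.mem_unitaryGroup_iff.1 hU, Matrix.one_mulVec]

lemma IsEnsemble.hasSum_charFn {ι : Type*} {w : ι → Mode n} {ρ : Mode n →L[ℂ] Mode n}
    (h : IsEnsemble w ρ) (α : Phase n) :
    HasSum (fun j => ⟪w j, displacement α (w j)⟫_ℂ) (charFn ρ α) :=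
  h.hasSum_trace (displacement α)

/-- Complex conjugation of the vectors of an ensemble turns `χ(α)` into `χ(-α*)`; the circuit of the
matrix `-U` turns this into `χ(U α*)`. -/
lemma exists_isReflectedState {U : Matrix (Fin n) (Fin n) ℂ}
    (hU : U ∈ Matrix.unitaryGroup (Fin n) ℂ) (hs : U.IsSymm) {ρ : Mode n →L[ℂ] Mode n}
    (hρ : IsDensityOperator ρ) : ∃ ρ', IsReflectedState U ρ ρ' := by
  obtain ⟨w, hw⟩ := hρ.exists_isEnsemble
  have hU' : -U ∈ Matrix.unitaryGroup (Fin n) ℂ := by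
    rw [Matrix.mem_unitaryGroup_iff, star_neg, neg_mul_neg, Matrix.mem_unitaryGroup_iff.1 hU]
  obtain ⟨𝒱, h𝒱⟩ := exists_intertwines hU' hs.neg
  have hsum : HasSum (fun j => ‖𝒱 (star (w j))‖ ^ 2) 1 := by
    simpa only [LinearIsometryEquiv.norm_map, norm_star_mode] using hw.hasSum_norm_sq hρ
  obtain ⟨ρ', hw'⟩ := exists_isEnsemble hsum.summable
  refine ⟨ρ', hw'.isDensityOperator hsum, fun α => (hw'.hasSum_charFn α).unique ?_⟩
  refine hasSum_of_eq (hw.hasSum_charFn (U.mulVec (star α))) fun j => ?_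
  set γ := U.mulVec (star α)
  have hα : (-U).mulVec (-star γ) = α := by
    rw [Matrix.neg_mulVec, Matrix.mulVec_neg, neg_neg, mulVec_star_mulVec_star hU hs]
  calc ⟪𝒱 (star (w j)), displacement α (𝒱 (star (w j)))⟫_ℂ
      = ⟪star (w j), displacement (-star γ) (star (w j))⟫_ℂ := by
        conv_lhs => rw [← hα]
        rw [← h𝒱, LinearIsometryEquiv.inner_map_map]
    _ = ⟪star (w j), star (displacement (-γ) (w j))⟫_ℂ := by
        rw [star_displacement, star_neg]
    _ = ⟪w j, displacement γ (w j)⟫_ℂ := by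
        rw [inner_star_star, inner_displacement_left, neg_neg]

end Reflection

/-! ### The law of the outcomes -/

section OutcomeLaw

variable {H : Type*} [NormedAddCommGroup H] [InnerProductSpace ℂ H]
  {Ω : Type*} [MeasurableSpace Ω] {ν : Measure Ω} {ι : Type*}

/-- The sum of the measures with the densities `|V wⱼ|²`, for an ensemble `wⱼ`. -/
def ensembleLaw (V : H →ₗᵢ[ℂ] Lp ℂ 2 ν) (w : ι → H) : Measure Ω :=
  Measure.sum fun j => ν.withDensity fun ω => ‖V (w j) ω‖ₑ ^ 2

lemma measurable_enorm_sq (f : Lp ℂ 2 ν) : Measurable fun ω => ‖f ω‖ₑ ^ 2 :=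
  (Lp.stronglyMeasurable f).measurable.enorm.pow_const 2

lemma isOutcomeLaw_ensembleLaw [CompleteSpace H] (V : H →ₗᵢ[ℂ] Lp ℂ 2 ν) {w : ι → H} {T : H →L[ℂ] H}
    (hw : IsEnsemble w T) (hT : IsDensityOperator T) :
    IsOutcomeLaw (POVM.ofIsometry V) T (ensembleLaw V w) := by
  have key : ∀ B, MeasurableSet B → HasSum (fun j => ∫ ω in B, ‖V (w j) ω‖ ^ 2 ∂ν)
      (trace (T ∘L isometryEffect V B)).re ∧
      (((trace (T ∘L isometryEffect V B)).re : ℝ) : ℂ) = trace (T ∘L isometryEffect V B) ∧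
      ensembleLaw V w B = ENNReal.ofReal (trace (T ∘L isometryEffect V B)).re := by
    intro B hB
    have h1 : HasSum (fun j => ((∫ ω in B, ‖V (w j) ω‖ ^ 2 ∂ν : ℝ) : ℂ))
        (trace (T ∘L isometryEffect V B)) := by
      refine hasSum_of_eq (hw.hasSum_trace (isometryEffect V B)) fun j => ?_
      rw [inner_isometryEffect, ← integral_complex_ofReal]
      simp only [inner_self_eq_ofReal_norm_sq]
    have h2 := Complex.hasSum_re h1
    simp only [Complex.ofReal_re] at h2
    refine ⟨h2, (Complex.hasSum_ofReal.2 h2).unique h1, ?_⟩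
    have h3 : ∀ j, ∫⁻ ω in B, ‖V (w j) ω‖ₑ ^ 2 ∂ν =
        ENNReal.ofReal (∫ ω in B, ‖V (w j) ω‖ ^ 2 ∂ν) := by
      intro j
      rw [ofReal_integral_eq_lintegral_ofReal
        ((Lp.memLp (V (w j))).integrable_norm_pow two_ne_zero).integrableOn
        (Filter.Eventually.of_forall fun ω => by positivity)]
      refine lintegral_congr fun ω => ?_
      rw [ENNReal.ofReal_pow (norm_nonneg _), ofReal_norm]
    rw [ensembleLaw, Measure.sum_apply _ hB]
    simp only [withDensity_apply _ hB, h3]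
    rw [← h2.tsum_eq, ENNReal.ofReal_tsum_of_nonneg (fun j => by positivity) h2.summable]
  refine ⟨⟨?_⟩, fun B hB => ?_⟩
  · rw [(key _ MeasurableSet.univ).2.2]
    have h : T ∘L isometryEffect V Set.univ = T := by
      have h1 : isometryEffect V Set.univ = 1 := (POVM.ofIsometry V).effect_univ
      rw [h1]
      rfl
    rw [h, hT.2]
    simp
  · obtain ⟨h1, h2, h3⟩ := key B hB
    rw [Measure.real, h3, ENNReal.toReal_ofReal (h1.nonneg fun j => by positivity), h2]
    rfl

lemma hasSum_integral_ensembleLaw (V : H →ₗᵢ[ℂ] Lp ℂ 2 ν) (w : ι → H)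
    [IsFiniteMeasure (ensembleLaw V w)] {φ : Ω → ℂ} (hφ : Measurable φ) (hb : ∀ ω, ‖φ ω‖ ≤ 1) :
    HasSum (fun j => ∫ ω, ⟪V (w j) ω, φ ω * V (w j) ω⟫_ℂ ∂ν) (∫ ω, φ ω ∂(ensembleLaw V w)) := by
  have hint : Integrable φ (ensembleLaw V w) :=
    Integrable.of_bound hφ.aestronglyMeasurable 1 (Filter.Eventually.of_forall hb)
  refine hasSum_of_eq (hasSum_integral_measure hint) fun j => ?_
  rw [integral_withDensity_eq_integral_toReal_smul (measurable_enorm_sq _)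
    (Filter.Eventually.of_forall fun ω => by simp)]
  refine integral_congr_ae (Filter.Eventually.of_forall fun ω => ?_)
  have h := inner_self_eq_ofReal_norm_sq (V (w j) ω)
  simp only [ENNReal.toReal_pow, toReal_enorm, Complex.real_smul]
  rw [← h, ← smul_eq_mul (φ ω), inner_smul_right, mul_comm]

end OutcomeLaw

section BellLaw

variable {n : ℕ} {ι κ : Type*}

/-- The phase whose empirical mean is `estimateSq`. -/
def bellPhase (α ζ : Phase n) : ℂ := Complex.exp (-(ζ ⬝ᵥ α - star ζ ⬝ᵥ star α))

lemma norm_bellPhase (α ζ : Phase n) : ‖bellPhase α ζ‖ = 1 := by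
  have h : (-(ζ ⬝ᵥ α - star ζ ⬝ᵥ star α)).re = 0 := by
    have h1 : star ζ ⬝ᵥ star α = star (ζ ⬝ᵥ α) := by
      rw [Matrix.star_dotProduct_star, dotProduct_comm]
    rw [h1]
    simp
  rw [bellPhase, Complex.norm_exp, h, Real.exp_zero]

lemma continuous_bellPhase (α : Phase n) : Continuous (bellPhase α) := by
  unfold bellPhase dotProduct
  fun_prop

/-- The mean of `bellPhase α` is `χ_ρ(α) χ_σ(α*)`, since `D(α) ⊗ D(α*)` is the multiplication with
`bellPhase α` in the Bell representation. -/
lemma integral_bellPhase {w : ι → Mode n} {z : κ → Mode n} {ρ σ : Mode n →L[ℂ] Mode n}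
    (hw : IsEnsemble w ρ) (hz : IsEnsemble z σ)
    [IsFiniteMeasure (ensembleLaw (bellIsometry n) fun p : ι × κ => tensorVec (w p.1) (z p.2))]
    (α : Phase n) :
    ∫ ζ, bellPhase α ζ ∂(ensembleLaw (bellIsometry n)
      fun p : ι × κ => tensorVec (w p.1) (z p.2)) = charFn ρ α * charFn σ (star α) := by
  refine HasSum.unique (hasSum_integral_ensembleLaw (bellIsometry n) _
    (continuous_bellPhase α).measurable fun ζ => (norm_bellPhase α ζ).le) ?_
  refine hasSum_of_eq (hasSum_mul_prod (hw.hasSum_charFn α) (hz.hasSum_charFn (star α)))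
    fun p => ?_
  rw [← inner_tensorVec, ← (bellIsometry n).inner_map_map, L2.inner_def, bellIsometry_tensorVec,
    bellIsometry_tensorVec]
  refine integral_congr_ae ?_
  filter_upwards [bellLp_ae (w p.1) (z p.2),
    bellLp_ae (displacement α (w p.1)) (displacement (star α) (z p.2))] with ζ h1 h2
  rw [h2, bellAmplitude_displacement, h1, mul_left_comm]
  rfl

lemma IsEnsemble.evolve {w : ι → Mode n} {ρ : Mode n →L[ℂ] Mode n} (hw : IsEnsemble w ρ)
    (𝒰 : Mode n ≃ₗᵢ[ℂ] Mode n) : IsEnsemble (fun j => 𝒰 (w j)) (evolve 𝒰 ρ) := by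
  refine ⟨by simpa only [LinearIsometryEquiv.norm_map] using hw.summable, fun x y => ?_⟩
  have h := hw.hasSum (𝒰.symm x) (𝒰.symm y)
  have e1 : ∀ u v, ⟪𝒰.symm u, v⟫_ℂ = ⟪u, 𝒰 v⟫_ℂ := fun u v => by
    rw [← 𝒰.inner_map_map, 𝒰.apply_symm_apply]
  have e2 : ∀ u v, ⟪v, 𝒰.symm u⟫_ℂ = ⟪𝒰 v, u⟫_ℂ := fun u v => by
    rw [← 𝒰.inner_map_map, 𝒰.apply_symm_apply]
  simp only [e1, e2] at h
  exact h

/-- The outcomes of the scheme for `ρ` and a reflected state of `ρ` have a law under which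
`bellPhase α` is an unbiased estimate of `χ_ρ(α)²`. -/
lemma exists_outcomeLaw {U : Matrix (Fin n) (Fin n) ℂ}
    (hU : U ∈ Matrix.unitaryGroup (Fin n) ℂ) (hs : U.IsSymm) {𝒰 : Mode n ≃ₗᵢ[ℂ] Mode n}
    (h𝒰 : IsLinearOptical U 𝒰) {ρ ρ' : Mode n →L[ℂ] Mode n} (hρ : IsDensityOperator ρ)
    (hρ' : IsReflectedState U ρ ρ') :
    ∃ μ : Measure (Phase n),
      IsOutcomeLaw (POVM.ofIsometry (bellIsometry n)) (tensorOp ρ (evolve 𝒰 ρ')) μ ∧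
      ∀ α, ∫ ζ, bellPhase α ζ ∂μ = charFn ρ α ^ 2 := by
  obtain ⟨w, hw⟩ := hρ.exists_isEnsemble
  obtain ⟨z, hz⟩ := hρ'.1.exists_isEnsemble
  have hz' := hz.evolve 𝒰
  have hwz := hw.tensor hz'
  have hsum : HasSum (fun p : _ × _ => ‖tensorVec (w p.1) (𝒰 (z p.2))‖ ^ 2) 1 := by
    have h := (hw.hasSum_norm_sq hρ).mul (hz.hasSum_norm_sq hρ'.1)
      (hw.summable.mul_of_nonneg hz.summable (fun _ => sq_nonneg _) (fun _ => sq_nonneg _))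
    rw [one_mul] at h
    simpa only [norm_tensorVec, mul_pow, LinearIsometryEquiv.norm_map] using h
  have hlaw := isOutcomeLaw_ensembleLaw (bellIsometry n) hwz (hwz.isDensityOperator hsum)
  have := hlaw.1
  refine ⟨_, hlaw, fun α => ?_⟩
  have hcircuit : charFn (evolve 𝒰 ρ') (star α) = charFn ρ' (U.transpose.mulVec (star α)) := by
    refine (hz'.hasSum_charFn _).unique ?_
    refine hasSum_of_eq (hz.hasSum_charFn (U.transpose.mulVec (star α))) fun k => ?_
    rw [← h𝒰, ← 𝒰.inner_map_map (z k), 𝒰.apply_symm_apply]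
  rw [integral_bellPhase hw hz' α, hcircuit, hρ'.2, hs.eq, mulVec_star_mulVec_star hU hs, sq]

end BellLaw

/-! ### Concentration of empirical means -/

section Concentration

open ProbabilityTheory

variable {Ω : Type*} [MeasurableSpace Ω] {μ : Measure Ω} [IsProbabilityMeasure μ]

lemma measure_sum_sub_integral_ge_le {X : Ω → ℝ} (hX : Measurable X)
    (hb : ∀ ω, X ω ∈ Set.Icc (-1) 1) (N : ℕ) {s : ℝ} (hs : 0 ≤ s) :
    (Measure.pi fun _ : Fin N => μ).real {ζ | s ≤ ∑ j, (X (ζ j) - ∫ ω, X ω ∂μ)} ≤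
      Real.exp (-s ^ 2 / (2 * N)) := by
  have hindep : iIndepFun (fun (j : Fin N) (ζ : Fin N → Ω) => X (ζ j) - ∫ ω, X ω ∂μ)
      (Measure.pi fun _ : Fin N => μ) :=
    iIndepFun_pi (X := fun _ ω => X ω - ∫ ω, X ω ∂μ) fun _ => (hX.sub_const _).aemeasurable
  have hsub : ∀ j : Fin N, HasSubgaussianMGF (fun ζ : Fin N → Ω => X (ζ j) - ∫ ω, X ω ∂μ) 1
      (Measure.pi fun _ : Fin N => μ) := by
    intro j
    have hmp := measurePreserving_eval (fun _ : Fin N => μ) j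
    have h := hasSubgaussianMGF_of_mem_Icc (μ := Measure.pi fun _ : Fin N => μ)
      (X := fun ζ : Fin N → Ω => X (ζ j)) (hX.comp (measurable_pi_apply j)).aemeasurable
      (Filter.Eventually.of_forall fun ζ => hb (ζ j))
    have e : ∫ ζ : Fin N → Ω, X (ζ j) ∂(Measure.pi fun _ : Fin N => μ) = ∫ ω, X ω ∂μ := by
      have h1 := integral_map (μ := Measure.pi fun _ : Fin N => μ) (f := X)
        hmp.measurable.aemeasurable
        hX.aestronglyMeasurable
      rw [hmp.map_eq] at h1
      exact h1.symm
    rw [e] at h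
    convert h using 1
    ext
    norm_num
  have h := HasSubgaussianMGF.measure_sum_ge_le_of_iIndepFun hindep (c := fun _ => 1)
    (s := Finset.univ) (fun j _ => hsub j) hs
  simpa using h

/-- Hoeffding's inequality for the empirical mean of a complex random variable of modulus at most
one: the real and imaginary parts have two tails each. -/
lemma measure_norm_mean_sub_integral_le {φ : Ω → ℂ} (hφ : Measurable φ) (hb : ∀ ω, ‖φ ω‖ ≤ 1)
    {N : ℕ} (hN : 0 < N) {t : ℝ} (ht : 0 ≤ t) :
    (Measure.pi fun _ : Fin N => μ).real
      {ζ | t < ‖(N : ℂ)⁻¹ * ∑ j, φ (ζ j) - ∫ ω, φ ω ∂μ‖} ≤ 4 * Real.exp (-(N * t ^ 2 / 8)) := by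
  set P := Measure.pi fun _ : Fin N => μ
  have hNR : (0 : ℝ) < N := by exact_mod_cast hN
  have hint : Integrable φ μ :=
    Integrable.of_bound hφ.aestronglyMeasurable 1 (Filter.Eventually.of_forall hb)
  have hre : ∀ ω, |(φ ω).re| ≤ 1 := fun ω => (Complex.abs_re_le_norm _).trans (hb ω)
  have him : ∀ ω, |(φ ω).im| ≤ 1 := fun ω => (Complex.abs_im_le_norm _).trans (hb ω)
  have hs : 0 ≤ N * (t / 2) := by positivity
  have hexp : Real.exp (-(N * (t / 2)) ^ 2 / (2 * N)) = Real.exp (-(N * t ^ 2 / 8)) := by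
    congr 1
    field_simp
    ring
  let T : (Ω → ℝ) → Set (Fin N → Ω) := fun X =>
    {ζ | N * (t / 2) ≤ ∑ j, (X (ζ j) - ∫ ω, X ω ∂μ)}
  have tail : ∀ X : Ω → ℝ, Measurable X → (∀ ω, |X ω| ≤ 1) →
      P.real (T X) ≤ Real.exp (-(N * t ^ 2 / 8)) := fun X hX hb => by
    rw [← hexp]
    exact measure_sum_sub_integral_ge_le hX (fun ω => abs_le.1 (hb ω)) N hs
  have hsubset : {ζ : Fin N → Ω | t < ‖(N : ℂ)⁻¹ * ∑ j, φ (ζ j) - ∫ ω, φ ω ∂μ‖} ⊆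
      (T (fun ω => (φ ω).re) ∪ T (fun ω => -(φ ω).re)) ∪
        (T (fun ω => (φ ω).im) ∪ T (fun ω => -(φ ω).im)) := by
    intro ζ hζ
    by_contra hc
    simp only [T, Set.mem_union, Set.mem_ofPred_eq, not_or, not_le, integral_neg,
      Finset.sum_sub_distrib, Finset.sum_neg_distrib, Finset.sum_const, Finset.card_univ,
      Fintype.card_fin, nsmul_eq_mul] at hc
    obtain ⟨⟨h1, h2⟩, h3, h4⟩ := hc
    set z : ℂ := (N : ℂ)⁻¹ * ∑ j, φ (ζ j) - ∫ ω, φ ω ∂μ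
    have hz : (N : ℂ) * z = ∑ j, φ (ζ j) - N * ∫ ω, φ ω ∂μ := by
      simp only [z]
      have : (N : ℂ) ≠ 0 := by exact_mod_cast hN.ne'
      field_simp
    have hzre : N * z.re = ∑ j, (φ (ζ j)).re - N * ∫ ω, (φ ω).re ∂μ := by
      have h := congrArg Complex.re hz
      have h5 : ∫ ω, (φ ω).re ∂μ = (∫ ω, φ ω ∂μ).re := integral_re hint
      simpa [h5] using h
    have hzim : N * z.im = ∑ j, (φ (ζ j)).im - N * ∫ ω, (φ ω).im ∂μ := by
      have h := congrArg Complex.im hz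
      have h5 : ∫ ω, (φ ω).im ∂μ = (∫ ω, φ ω ∂μ).im := integral_im hint
      simpa [h5] using h
    have h6 : |N * z.re| < N * (t / 2) := abs_lt.2 ⟨by linarith, by linarith⟩
    have h7 : |N * z.im| < N * (t / 2) := abs_lt.2 ⟨by linarith, by linarith⟩
    rw [abs_mul, abs_of_pos hNR, mul_lt_mul_iff_right₀ hNR] at h6 h7
    have h8 := Complex.norm_le_abs_re_add_abs_im z
    have h9 : t < ‖z‖ := hζ
    linarith
  have hmre := Complex.measurable_re.comp hφ
  have hmim := Complex.measurable_im.comp hφ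
  calc P.real {ζ | t < ‖(N : ℂ)⁻¹ * ∑ j, φ (ζ j) - ∫ ω, φ ω ∂μ‖}
      ≤ (P.real (T fun ω => (φ ω).re) + P.real (T fun ω => -(φ ω).re)) +
        (P.real (T fun ω => (φ ω).im) + P.real (T fun ω => -(φ ω).im)) :=
        (measureReal_mono hsubset).trans ((measureReal_union_le _ _).trans
          (add_le_add (measureReal_union_le _ _) (measureReal_union_le _ _)))
    _ ≤ 4 * Real.exp (-(N * t ^ 2 / 8)) := by
        have e1 := tail _ hmre hre
        have e2 := tail _ hmre.neg fun ω => by simpa using hre ω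
        have e3 := tail _ hmim him
        have e4 := tail _ hmim.neg fun ω => by simpa using him ω
        exact (add_le_add (add_le_add e1 e2) (add_le_add e3 e4)).trans (by linarith)

end Concentration

/-! ### Square roots up to a sign -/

section SquareRoot

lemma min_norm_sub_le_of_sq {u v : ℂ} {ε : ℝ} (hε : 0 ≤ ε) (h : ‖u ^ 2 - v ^ 2‖ ≤ ε ^ 2) :
    min ‖u - v‖ ‖-u - v‖ ≤ ε := by
  by_contra hc
  rw [not_le, lt_min_iff] at hc
  have h1 : ‖u ^ 2 - v ^ 2‖ = ‖u - v‖ * ‖-u - v‖ := by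
    rw [← norm_mul, ← norm_neg]
    congr 1
    ring
  nlinarith [mul_lt_mul'' hc.1 hc.2 hε hε]

variable {n : ℕ}

/-- Thresholding the square root: below the threshold `χ` itself is at most `ε` in modulus, above it
the two square roots of close numbers are close up to a sign. -/
lemma min_norm_estimate_sub_le {N : ℕ} {ε : ℝ} (hε : 0 ≤ ε) {ζ : Fin N → Phase n} {α : Phase n}
    {χ : ℂ} (h : ‖estimateSq ζ α - χ ^ 2‖ ≤ ε ^ 2 / 3) :
    min ‖estimate ε ζ α - χ‖ ‖-estimate ε ζ α - χ‖ ≤ ε := by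
  rw [estimate]
  split_ifs with hv
  · have h1 : ‖χ‖ ^ 2 ≤ ε ^ 2 := by
      rw [← norm_pow]
      calc ‖χ ^ 2‖ = ‖estimateSq ζ α - (estimateSq ζ α - χ ^ 2)‖ := by congr 1; ring
        _ ≤ ‖estimateSq ζ α‖ + ‖estimateSq ζ α - χ ^ 2‖ := norm_sub_le _ _
        _ ≤ ε ^ 2 := by linarith
    simpa using le_of_sq_le_sq h1 hε
  · refine min_norm_sub_le_of_sq hε ?_
    have h2 : (estimateSq ζ α ^ (1 / 2 : ℂ)) ^ 2 = estimateSq ζ α := by simp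
    rw [h2]
    nlinarith [sq_nonneg ε]

end SquareRoot

/-! ### Accuracy of the estimates -/

section Scheme

variable {n : ℕ}

/-- The number of copies suffices for the union bound over `M` points. -/
lemma four_mul_exp_le {ε δ : ℝ} {M N : ℕ} (hε : 0 < ε) (hδ : 0 < δ) (hM : 2 * δ ≤ M)
    (hN : 216 * Real.log (M / δ) / ε ^ 4 ≤ N) :
    M * (4 * Real.exp (-(N * (ε ^ 2 / 3) ^ 2 / 8))) ≤ δ := by
  have hM0 : (0 : ℝ) < M := by linarith
  set r : ℝ := M / δ
  have hr : 0 < r := div_pos hM0 hδ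
  have hr2 : 2 ≤ r := by rwa [le_div_iff₀ hδ]
  have h1 : Real.exp (-(N * (ε ^ 2 / 3) ^ 2 / 8)) ≤ (r ^ 3)⁻¹ := by
    rw [← Real.exp_log (pow_pos hr 3), ← Real.exp_neg, Real.exp_le_exp, Real.log_pow]
    rw [div_le_iff₀ (by positivity)] at hN
    push_cast
    nlinarith
  have hMr : (M : ℝ) = r * δ := by
    simp only [r]
    field_simp
  calc M * (4 * Real.exp (-(N * (ε ^ 2 / 3) ^ 2 / 8))) ≤ r * δ * (4 * (r ^ 3)⁻¹) := by
        rw [hMr]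
        gcongr
    _ = δ * (4 / r ^ 2) := by field_simp
    _ ≤ δ * 1 := by
        gcongr
        rw [div_le_one (by positivity)]
        nlinarith
    _ = δ := mul_one δ

/-- If `bellPhase α` has the mean `χ(α)²` for all `α`, the estimates are accurate with high
probability. -/
lemma measure_estimate_ge {μ : Measure (Phase n)} [IsProbabilityMeasure μ] {χ : Phase n → ℂ}
    (hμ : ∀ α, ∫ ζ, bellPhase α ζ ∂μ = χ α ^ 2) {ε δ : ℝ} {M N : ℕ} (hε : 0 < ε) (hδ : 0 < δ)
    (hM : 2 * δ ≤ M) (hN : 216 * Real.log (M / δ) / ε ^ 4 ≤ N) (α : Fin M → Phase n) :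
    1 - δ ≤ (Measure.pi fun _ : Fin N => μ).real
      {ζ | ∀ i, min ‖estimate ε ζ (α i) - χ (α i)‖ ‖-estimate ε ζ (α i) - χ (α i)‖ ≤ ε} := by
  set P := Measure.pi fun _ : Fin N => μ
  have hN0 : 0 < N := by
    have h1 : 1 < M / δ := by
      rw [lt_div_iff₀ hδ]
      linarith
    have h2 : 0 < 216 * Real.log (M / δ) / ε ^ 4 := by
      have := Real.log_pos h1
      positivity
    exact_mod_cast h2.trans_le hN
  let A : Fin M → Set (Fin N → Phase n) := fun i =>
    {ζ | ε ^ 2 / 3 < ‖estimateSq ζ (α i) - χ (α i) ^ 2‖}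
  have hA : ∀ i, P.real (A i) ≤ 4 * Real.exp (-(N * (ε ^ 2 / 3) ^ 2 / 8)) := by
    intro i
    have h := measure_norm_mean_sub_integral_le (μ := μ) (continuous_bellPhase (α i)).measurable
      (fun ζ => (norm_bellPhase (α i) ζ).le) hN0 (t := ε ^ 2 / 3) (by positivity)
    rwa [hμ] at h
  have hmeas : MeasurableSet (⋃ i, A i) := by
    refine MeasurableSet.iUnion fun i => measurableSet_lt measurable_const ?_
    have hc : Continuous fun ζ : Fin N → Phase n => estimateSq ζ (α i) := by
      unfold estimateSq dotProduct
      fun_prop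
    exact ((hc.sub continuous_const).norm).measurable
  have hunion : P.real (⋃ i, A i) ≤ δ := by
    refine (measureReal_iUnion_fintype_le A).trans ((Finset.sum_le_sum fun i _ => hA i).trans ?_)
    rw [Finset.sum_const, Finset.card_univ, Fintype.card_fin, nsmul_eq_mul]
    exact four_mul_exp_le hε hδ hM hN
  calc 1 - δ ≤ 1 - P.real (⋃ i, A i) := by linarith
    _ = P.real (⋃ i, A i)ᶜ := (probReal_compl_eq_one_sub hmeas).symm
    _ ≤ _ := by
      refine measureReal_mono fun ζ hζ i => min_norm_estimate_sub_le hε.le ?_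
      by_contra hc
      exact hζ (Set.mem_iUnion.2 ⟨i, not_le.1 hc⟩)

end Scheme

end CVLearning

end

theorem mainTheorem2 :
    ∃ C : ℝ, 0 < C ∧
      ∀ (n : ℕ) (U : Matrix (Fin n) (Fin n) ℂ), U ∈ Matrix.unitaryGroup (Fin n) ℂ → U.IsSymm →
        ∃ (𝒰 : Mode n ≃ₗᵢ[ℂ] Mode n) (E : POVM (Phase n) (HTensor (Mode n) (Mode n))),
          IsLinearOptical U 𝒰 ∧ IsBellMeasurement E ∧
          ∀ ρ : Mode n →L[ℂ] Mode n, IsDensityOperator ρ →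
            (∃ ρ', IsReflectedState U ρ ρ') ∧
            ∀ ρ' : Mode n →L[ℂ] Mode n, IsReflectedState U ρ ρ' →
              ∃ μ : MeasureTheory.Measure (Phase n),
                IsOutcomeLaw E (tensorOp ρ (evolve 𝒰 ρ')) μ ∧
                ∀ (ε δ : ℝ) (M N : ℕ), 0 < ε → 0 < δ → 2 * δ ≤ M →
                  C * Real.log (M / δ) / ε ^ 4 ≤ N →
                  ∀ α : Fin M → Phase n,
                    1 - δ ≤ (MeasureTheory.Measure.pi fun _ : Fin N => μ).real
                      {ζ | ∀ i, min ‖estimate ε ζ (α i) - charFn ρ (α i)‖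
                        ‖-estimate ε ζ (α i) - charFn ρ (α i)‖ ≤ ε} := by
  refine ⟨216, by norm_num, fun n U hU hs => ?_⟩
  obtain ⟨𝒰, h𝒰⟩ := exists_isLinearOptical hU hs
  refine ⟨𝒰, POVM.ofIsometry (bellIsometry n), h𝒰, isBellMeasurement_ofIsometry, fun ρ hρ =>
    ⟨exists_isReflectedState hU hs hρ, fun ρ' hρ' => ?_⟩⟩
  obtain ⟨μ, hμ, hmean⟩ := exists_outcomeLaw hU hs h𝒰 hρ hρ'
  have := hμ.1
  exact ⟨μ, hμ, fun ε δ M N hε hδ hM hN α => measure_estimate_ge hmean hε hδ hM hN α⟩
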